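/- Let $\mathcal D$ be the space of smooth compactly supported vector fields $\mathbb R^3\to\mathbb R^3$, $\langle f,g\rangle=\int f\cdot g\,dx$, and let $\mathfrak W(\mathbb R^3)$ be the Weyl C*-algebra generated by unitaries $e^{iA(f)},e^{iE(g)}$ ($f,g\in\mathcal D$), each family being a representation of the additive group $\mathcal D$, with $e^{iA(f)}e^{iE(g)}=e^{i\langle f,g\rangle}e^{iE(g)}e^{iA(f)}$. Put $e^{iB(f)}=e^{iA(\operatorname{curl}f)}$ and $e^{i\,\mathrm{div}E(s)}=e^{iE(-\operatorname{grad}s)}$ for scalar test functions $s$. For $O\subset\mathbb R^3$ let $\mathfrak W(O)$ be the C*-subalgebra generated by the Weyl operators of test functions supported in $O$, and $\mathfrak A(O)\subset\mathfrak W(O)$ the subalgebra of elements invariant under all gauge transformations $\mathrm{Ad}\,e^{iE(\operatorname{grad}s)}$, $s$ a scalar test function on $\mathbb R^3$. Let $\mathscr X\subset\mathbb R^3$ be finite, $x_1,x_2\in\mathscr X$, and let $\gamma_0:[0,1]\to\mathbb R^3$ be a smooth injective path from $x_1$ to $x_2$. Let $R>0$ be such that $|\gamma_0(u)-x_j|\ge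 R\,u(1-u)$ for $u\in(0,1)$, $j=1,2$, and such that for $|y|<R$ the paths $\gamma_y(u)=\gamma_0(u)+u(1-u)y$ meet no point of $\mathscr X\setminus\{x_1,x_2\}$. Let $q\in\mathbb R$ and let $s$ be a real scalar test function supported in the open ball of radius $R$ about $0$ with $\int s=q$. For $0<u<1$ let $a_u(x)=\int dy\,s(y)\,\delta(x-\gamma_y(u))\,\dot\gamma_y(u)$, that is, $a_u(x)=(u(1-u))^{-3}s(y)\,\dot\gamma_{y}(u)$ with $y=(x-\gamma_0(u))/(u(1-u))$, and for $0<\varepsilon<\tfrac12$ let $b_\varepsilon(x)=\int_\varepsilon^{1-\varepsilon}a_u(x)\,du$. Then each $b_\varepsilon$ belongs to $\mathcal D$ and is supported in $\mathbb R^3\setminus\mathscr X$; the limits $\beta(A)=\lim_{\varepsilon\searrow0}e^{iA(b_\varepsilon)}Ae^{-iA(b_\varepsilon)}$ exist in norm for all $A\in\mathfrak A(\mathbb R^3)$ and define a $*$-automorphism $\beta=\beta_{q,x_1x_2}$ of $\mathfrak A(\mathbb R^3)$, which restricts to a $*$-automorphism of $\mathfrak A(\mathbb R^3\setminus\mathscr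 X)$. This restriction has the following properties. (i) $\beta(e^{i\,\mathrm{div}E(s')})=e^{i\,\mathrm{div}E(s')}$ for every scalar test function $s'$ supported in $\mathbb R^3\setminus\mathscr X$. (ii) Let $\tau\subset\mathbb R^3$ be a region that is the union of finitely many smooth, orientation preserving parametrized cubes $[0,1]^3\to\mathbb R^3$, injective on the open cube and with pairwise disjoint images of the open cubes, and let its boundary, the closed surface $\sigma=\partial\tau$, be contained in $\mathbb R^3\setminus\mathscr X$. Then there is $\delta>0$ such that for every scalar test function $s'$ supported in the open ball of radius $\delta$ about $0$ with $\int s'=1$ the function $g_\sigma(x)=\int_\sigma s'(x-z)\,n_\sigma(z)\,dS(z)$ ($n_\sigma$ the outward unit normal; the integral is the sum of the integrals over the oriented faces of the cubes) belongs to $\mathcal D$, is supported in $\mathbb R^3\setminus\mathscr X$, and $$\beta(e^{iE(g_\sigma)})=\begin{cases}e^{iq}\,e^{iE(g_\sigma)}&\text{if }x_1\in\tau,\ x_2\notin\tau,\\ e^{-iq}\,e^{iE(g_\sigma)}&\text{if }x_1\notin\tau,\ x_2\in\tau,\\ e^{iE(g_\sigma)}&\text{if }\tau\text{ contains neither or both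 of }x_1,x_2.\end{cases}$$ (iii) Let $O\subset\mathbb R^3$ be open with compact closure $\overline O\subset\mathbb R^3\setminus\mathscr X$, and let $\overline O$ be contractible to a point within $\mathbb R^3\setminus\mathscr X$ (for example, $\overline O$ is contractible, or is contained in a contractible subset of $\mathbb R^3\setminus\mathscr X$). Then there is $f_O\in\mathcal D$ supported in $\mathbb R^3\setminus\mathscr X$ such that $\beta(A)=e^{iB(f_O)}Ae^{-iB(f_O)}$ for all $A\in\mathfrak A(O)$. -/

import Mathlib

open MeasureTheory Set Filter Topology
open scoped ContDiff Distributions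

namespace GaugeBridge

noncomputable section

/-! ### Test functions and vector calculus on `ℝ³` -/

/-- Euclidean space `ℝ³`. -/
abbrev R3 : Type := EuclideanSpace ℝ (Fin 3)

/-- Real scalar test functions on `ℝ³`. -/
abbrev ScalarTest : Type := 𝓓((⊤ : TopologicalSpace.Opens R3), ℝ)

/-- Real vector-valued test functions on `ℝ³`. -/
abbrev VectorTest : Type := 𝓓((⊤ : TopologicalSpace.Opens R3), R3)

/-- The pairing `⟨f, g⟩ = ∫ f(x) · g(x) dx`. -/
def pairing (f g : VectorTest) : ℝ := ∫ x, inner ℝ (f x) (g x)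

/-- The vector product on `ℝ³`. -/
def cross (a b : R3) : R3 := WithLp.toLp 2 (crossProduct a.ofLp b.ofLp)

/-- The partial derivative `∂ⱼ fᵢ (x)`. -/
def partialDeriv (f : R3 → R3) (j i : Fin 3) (x : R3) : ℝ :=
  fderiv ℝ f x (EuclideanSpace.single j 1) i

/-- The curl of a vector field. -/
def curlFun (f : R3 → R3) (x : R3) : R3 :=
  !₂[partialDeriv f 1 2 x - partialDeriv f 2 1 x,
     partialDeriv f 2 0 x - partialDeriv f 0 2 x,
     partialDeriv f 0 1 x - partialDeriv f 1 0 x]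

theorem tsupport_gradient_subset (s : R3 → ℝ) : tsupport (gradient s) ⊆ tsupport s := by
  refine closure_minimal (fun x hx => ?_) (isClosed_tsupport s)
  by_contra h
  exact hx (by simp [gradient, fderiv_of_notMem_tsupport ℝ h])

theorem tsupport_curlFun_subset (f : R3 → R3) : tsupport (curlFun f) ⊆ tsupport f := by
  refine closure_minimal (fun x hx => ?_) (isClosed_tsupport f)
  by_contra h
  refine hx ?_
  ext i
  fin_cases i <;> simp [curlFun, partialDeriv, fderiv_of_notMem_tsupport ℝ h]

theorem contDiff_partialDeriv {f : R3 → R3} (hf : ContDiff ℝ ∞ f) (j i : Fin 3) :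
    ContDiff ℝ ∞ (partialDeriv f j i) := by
  have h : ContDiff ℝ ∞ fun x => fderiv ℝ f x (EuclideanSpace.single j 1) :=
    (hf.fderiv_right (m := ∞) le_rfl).clm_apply contDiff_const
  exact (contDiff_piLp 2).1 h i

/-- The gradient of a scalar test function. -/
def grad (s : ScalarTest) : VectorTest where
  toFun := gradient s
  contDiff' := (InnerProductSpace.toDual ℝ R3).symm.contDiff.comp
    (s.contDiff.fderiv_right (m := ∞) le_rfl)
  hasCompactSupport' := s.hasCompactSupport.mono'
    (subset_tsupport _ |>.trans (tsupport_gradient_subset s))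
  tsupport_subset' := fun _ _ => trivial

/-- The curl of a vector test function. -/
def curl (f : VectorTest) : VectorTest where
  toFun := curlFun f
  contDiff' := by
    have hf : ContDiff ℝ ∞ f := f.contDiff
    refine (contDiff_piLp 2).2 fun i => ?_
    fin_cases i
    · exact (contDiff_partialDeriv hf 1 2).sub (contDiff_partialDeriv hf 2 1)
    · exact (contDiff_partialDeriv hf 2 0).sub (contDiff_partialDeriv hf 0 2)
    · exact (contDiff_partialDeriv hf 0 1).sub (contDiff_partialDeriv hf 1 0)
  hasCompactSupport' := f.hasCompactSupport.mono'
    (subset_tsupport _ |>.trans (tsupport_curlFun_subset f))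
  tsupport_subset' := fun _ _ => trivial

/-! ### The Weyl algebra

The Weyl C*-algebra over `VectorTest × VectorTest` is realized in its regular representation on
`ℓ²(VectorTest × VectorTest)`. -/

/-- The unitary operator `(T ψ)(w) = c(w) ψ(e(w))` on `ℓ²(V)`, for a bijection `e` of `V` and
phases `c`. -/
def phasePerm {V : Type*} (c : V → Circle) (e : V ≃ V) :
    lp (fun _ : V => ℂ) 2 ≃ₗᵢ[ℂ] lp (fun _ : V => ℂ) 2 where
  toFun ψ := ⟨fun w => (c w : ℂ) * ψ (e w), by
    have h := (memℓp_gen_iff (by norm_num)).1 (lp.memℓp ψ)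
    refine (memℓp_gen_iff (by norm_num)).2 ?_
    simpa [Function.comp_def, Circle.norm_coe] using
      (e.summable_iff (f := fun w => ‖ψ w‖ ^ (2 : ENNReal).toReal)).2 h⟩
  invFun ψ := ⟨fun w => ((c (e.symm w))⁻¹ : Circle) * ψ (e.symm w), by
    have h := (memℓp_gen_iff (by norm_num)).1 (lp.memℓp ψ)
    refine (memℓp_gen_iff (by norm_num)).2 ?_
    simpa [Function.comp_def, Circle.norm_coe] using
      (e.symm.summable_iff (f := fun w => ‖ψ w‖ ^ (2 : ENNReal).toReal)).2 h⟩
  map_add' ψ φ := by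
    ext w
    exact mul_add _ _ _
  map_smul' z ψ := by
    ext w
    exact mul_left_comm _ _ _
  left_inv ψ := by
    ext w
    simp
  right_inv ψ := by
    ext w
    simp
  norm_map' ψ := by
    rw [lp.norm_eq_tsum_rpow (by norm_num), lp.norm_eq_tsum_rpow (by norm_num)]
    congr 1
    rw [← e.tsum_eq (fun w => ‖ψ w‖ ^ (2 : ENNReal).toReal)]
    exact tsum_congr fun w => by simp [Circle.norm_coe]

@[simp]
theorem phasePerm_apply {V : Type*} (c : V → Circle) (e : V ≃ V) (ψ : lp (fun _ : V => ℂ) 2)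
    (w : V) : phasePerm c e ψ w = (c w : ℂ) * ψ (e w) := rfl

/-- The representation space `ℓ²(VectorTest × VectorTest)`. -/
abbrev WeylSpace : Type := lp (fun _ : VectorTest × VectorTest => ℂ) 2

/-- Bounded operators on the representation space. -/
abbrev Op : Type := WeylSpace →L[ℂ] WeylSpace

/-- The unitary `e^{iA(f)}`, acting by `(e^{iA(f)} ψ)(h, k) = e^{i⟨f, k⟩} ψ(h - f, k)`. -/
def expA (f : VectorTest) : unitary Op :=
  Unitary.linearIsometryEquiv.symm
    (phasePerm (fun w => Circle.exp (pairing f w.2))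
      ((Equiv.subRight f).prodCongr (Equiv.refl VectorTest)))

/-- The unitary `e^{iE(g)}`, acting by `(e^{iE(g)} ψ)(h, k) = ψ(h, k - g)`. -/
def expE (g : VectorTest) : unitary Op :=
  Unitary.linearIsometryEquiv.symm
    (phasePerm 1 ((Equiv.refl VectorTest).prodCongr (Equiv.subRight g)))

/-- The unitary `e^{iB(f)}` of the magnetic field `B = curl A`. -/
def expB (f : VectorTest) : unitary Op := expA (curl f)

/-- The unitary `e^{i div E(s)}`, where `div E(s) = -E(grad s)`. -/
def expDivE (s : ScalarTest) : unitary Op := expE (-grad s)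

@[simp]
theorem expA_apply (f : VectorTest) (ψ : WeylSpace) (w : VectorTest × VectorTest) :
    (expA f : Op) ψ w = (Circle.exp (pairing f w.2) : ℂ) * ψ (w.1 - f, w.2) := rfl

@[simp]
theorem expE_apply (g : VectorTest) (ψ : WeylSpace) (w : VectorTest × VectorTest) :
    (expE g : Op) ψ w = ψ (w.1, w.2 - g) := by
  change ((1 : Circle) : ℂ) * ψ (w.1, w.2 - g) = _
  simp

theorem integrable_inner (f g : VectorTest) : Integrable fun x => inner ℝ (f x) (g x) := by
  refine (f.continuous.inner g.continuous).integrable_of_hasCompactSupport ?_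
  refine f.hasCompactSupport.mono fun x hx h => hx ?_
  simp [h]

theorem pairing_add_left (f f' g : VectorTest) :
    pairing (f + f') g = pairing f g + pairing f' g := by
  rw [pairing, pairing, pairing, ← integral_add (integrable_inner f g) (integrable_inner f' g)]
  exact integral_congr_ae (.of_forall fun x => inner_add_left _ _ _)

theorem pairing_sub_right (f g g' : VectorTest) :
    pairing f (g - g') = pairing f g - pairing f g' := by
  rw [pairing, pairing, pairing, ← integral_sub (integrable_inner f g) (integrable_inner f g')]
  exact integral_congr_ae (.of_forall fun x => inner_sub_right _ _ _)

theorem expA_add (f f' : VectorTest) : expA (f + f') = expA f * expA f' := by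
  refine Subtype.ext (ContinuousLinearMap.ext fun ψ => lp.ext (funext fun w => ?_))
  change (expA (f + f') : Op) ψ w = (expA f : Op) ((expA f' : Op) ψ) w
  simp only [expA_apply, pairing_add_left, Circle.exp_add, Circle.coe_mul, mul_assoc]
  rw [sub_sub]

theorem expE_add (g g' : VectorTest) : expE (g + g') = expE g * expE g' := by
  refine Subtype.ext (ContinuousLinearMap.ext fun ψ => lp.ext (funext fun w => ?_))
  change (expE (g + g') : Op) ψ w = (expE g : Op) ((expE g' : Op) ψ) w
  simp only [expE_apply]
  rw [sub_sub]

/-- The Weyl relations `e^{iA(f)} e^{iE(g)} = e^{i⟨f, g⟩} e^{iE(g)} e^{iA(f)}`. -/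
theorem expA_mul_expE (f g : VectorTest) :
    (expA f : Op) * (expE g : Op) =
      Complex.exp (Complex.I * pairing f g) • ((expE g : Op) * (expA f : Op)) := by
  refine ContinuousLinearMap.ext fun ψ => lp.ext (funext fun w => ?_)
  change (expA f : Op) ((expE g : Op) ψ) w =
    Complex.exp (Complex.I * pairing f g) * (expE g : Op) ((expA f : Op) ψ) w
  simp only [expA_apply, expE_apply, pairing_sub_right, Circle.coe_exp, ← mul_assoc,
    ← Complex.exp_add]
  congr 2
  push_cast
  ring

/-- The C*-algebra `𝔚(O)` generated by the Weyl operators of test functions supported in `O`. -/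
def weylAlgebra (O : Set R3) : StarSubalgebra ℂ Op :=
  (StarAlgebra.adjoin ℂ
    ({a : Op | ∃ f : VectorTest, tsupport f ⊆ O ∧ a = expA f} ∪
      {a : Op | ∃ g : VectorTest, tsupport g ⊆ O ∧ a = expE g})).topologicalClosure

/-- The adjoint action `Ad U (a) = U a U*` of a unitary. -/
def Ad (U : unitary Op) : Op ≃⋆ₐ[ℂ] Op := Unitary.conjStarAlgAut ℂ Op U

/-- The observable algebra `𝔄(O)`: the part of `𝔚(O)` that is invariant under all gauge
transformations `Ad e^{iE(grad s)}`, where `s` is any scalar test function. -/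
def observables (O : Set R3) : StarSubalgebra ℂ Op where
  carrier := {a | a ∈ weylAlgebra O ∧ ∀ s : ScalarTest, Ad (expE (grad s)) a = a}
  mul_mem' ha hb := ⟨mul_mem ha.1 hb.1, fun s => by rw [map_mul, ha.2 s, hb.2 s]⟩
  add_mem' ha hb := ⟨add_mem ha.1 hb.1, fun s => by rw [map_add, ha.2 s, hb.2 s]⟩
  algebraMap_mem' z := ⟨algebraMap_mem _ z, fun s => AlgHomClass.commutes _ z⟩
  star_mem' ha := ⟨star_mem ha.1, fun s => by rw [map_star, ha.2 s]⟩

theorem observables_mono {O O' : Set R3} (h : O ⊆ O') : observables O ≤ observables O' := by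
  refine fun a ha => ⟨StarSubalgebra.topologicalClosure_mono (StarAlgebra.adjoin_mono ?_) ha.1, ha.2⟩
  exact union_subset_union (fun _ ⟨f, hf, e⟩ => ⟨f, hf.trans h, e⟩)
    (fun _ ⟨g, hg, e⟩ => ⟨g, hg.trans h, e⟩)

theorem expE_mem_observables {O : Set R3} {g : VectorTest} (hg : tsupport g ⊆ O) :
    (expE g : Op) ∈ observables O := by
  refine ⟨StarSubalgebra.le_topologicalClosure _
    (StarAlgebra.subset_adjoin ℂ _ (Or.inr ⟨g, hg, rfl⟩)), fun s => ?_⟩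
  have h : expE (grad s) * expE g * star (expE (grad s)) = expE g := by
    rw [← expE_add, add_comm, expE_add, mul_assoc, Unitary.mul_star_self, mul_one]
  exact congrArg Subtype.val h

theorem tsupport_neg_grad_subset {O : Set R3} {s : ScalarTest} (hs : tsupport s ⊆ O) :
    tsupport (-grad s : VectorTest) ⊆ O := by
  have h : ((-grad s : VectorTest) : R3 → R3) = -gradient s := rfl
  rw [h, tsupport_neg]
  exact (tsupport_gradient_subset s).trans hs

/-- `e^{iE(g)}` as an element of `𝔄(O)`, for `g` supported in `O`. -/
def obsE (O : Set R3) (g : VectorTest) (hg : tsupport g ⊆ O) : observables O :=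
  ⟨expE g, expE_mem_observables hg⟩

/-- `e^{i div E(s)}` as an element of `𝔄(O)`, for `s` supported in `O`. -/
def obsDivE (O : Set R3) (s : ScalarTest) (hs : tsupport s ⊆ O) : observables O :=
  ⟨expDivE s, expE_mem_observables (tsupport_neg_grad_subset hs)⟩

/-! ### The test functions of a gauge bridge -/

/-- The neighbouring path `γ_y(u) = γ(u) + u(1 - u) y`. -/
def nbrPath (γ : ℝ → R3) (y : R3) (u : ℝ) : R3 := γ u + (u * (1 - u)) • y

/-- The function `a_u(x) = ∫ s(y) δ(x - γ_y(u)) γ_y'(u) dy` for `0 < u < 1`, where the Dirac measure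
is evaluated: `γ_y(u) = x` holds for `y = (u(1 - u))⁻¹ (x - γ(u))` only, and `y ↦ γ_y(u)` has the
Jacobian `(u(1 - u))³`. See `integral_bridgeDensity`. -/
def bridgeDensity (γ : ℝ → R3) (s : R3 → ℝ) (u : ℝ) (x : R3) : R3 :=
  let y : R3 := (u * (1 - u))⁻¹ • (x - γ u)
  (((u * (1 - u)) ^ 3)⁻¹ * s y) • deriv (nbrPath γ y) u

/-- The distributional meaning of `a_u`. -/
theorem integral_bridgeDensity (γ : ℝ → R3) (s : R3 → ℝ) {u : ℝ} (hu : u ∈ Ioo (0 : ℝ) 1)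
    (g : R3 → R3) :
    ∫ x, inner ℝ (bridgeDensity γ s u x) (g x) =
      ∫ y, s y * inner ℝ (deriv (nbrPath γ y) u) (g (nbrPath γ y u)) := by
  have hc : 0 < u * (1 - u) := mul_pos hu.1 (sub_pos.2 hu.2)
  set F : R3 → ℝ := fun x => inner ℝ (bridgeDensity γ s u x) (g x) with hF
  have h1 : ∫ x, F x = ∫ x, F (γ u + x) := (integral_add_left_eq_self F (γ u)).symm
  have h2 := Measure.integral_comp_smul (volume : Measure R3) (fun x => F (γ u + x)) (u * (1 - u))
  rw [finrank_euclideanSpace_fin, abs_of_pos (by positivity), smul_eq_mul] at h2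
  have h3 : ∫ x, F (γ u + x) = (u * (1 - u)) ^ 3 * ∫ y, F (γ u + (u * (1 - u)) • y) := by
    rw [h2, ← mul_assoc, mul_inv_cancel₀ (by positivity), one_mul]
  rw [h1, h3, ← integral_const_mul]
  refine integral_congr_ae (.of_forall fun y => ?_)
  have hy : (u * (1 - u))⁻¹ • (γ u + (u * (1 - u)) • y - γ u) = y := by
    rw [add_sub_cancel_left, smul_smul, inv_mul_cancel₀ hc.ne', one_smul]
  have hc3 : (u * (1 - u)) ^ 3 ≠ 0 := by positivity
  simp only [hF, bridgeDensity, hy, real_inner_smul_left]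
  rw [← mul_assoc, ← mul_assoc, mul_inv_cancel₀ hc3, one_mul]
  rfl

/-- The function `b_ε(x) = ∫_ε^{1-ε} a_u(x) du`. -/
def bridgeFun (γ : ℝ → R3) (s : R3 → ℝ) (ε : ℝ) (x : R3) : R3 :=
  ∫ u in ε..(1 - ε), bridgeDensity γ s u x

/-! ### Closed surfaces as boundaries of regions -/

/-- The matrix of partial derivatives of a map `τ` from the cube to `ℝ³`. -/
def jacobian (τ : (Fin 3 → ℝ) → R3) (u : Fin 3 → ℝ) : Matrix (Fin 3) (Fin 3) ℝ :=
  Matrix.of fun i j => fderiv ℝ τ u (Pi.single j 1) i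

/-- A region in `ℝ³`, given by finitely many non-overlapping smooth orientation preserving
parametrized cubes `[0,1]³ → ℝ³`. -/
structure Region where
  /-- The number of cubes. -/
  n : ℕ
  /-- The parametrizations; only their restrictions to `[0,1]³` matter. -/
  cell : Fin n → (Fin 3 → ℝ) → R3
  smooth : ∀ k, ContDiff ℝ ∞ (cell k)
  injOn : ∀ k, InjOn (cell k) (univ.pi fun _ => Ioo (0 : ℝ) 1)
  orientation : ∀ k, ∀ u ∈ univ.pi (fun _ : Fin 3 => Ioo (0 : ℝ) 1), 0 ≤ (jacobian (cell k) u).det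
  disjoint : Pairwise fun k l =>
    Disjoint (cell k '' univ.pi fun _ => Ioo (0 : ℝ) 1) (cell l '' univ.pi fun _ => Ioo (0 : ℝ) 1)

/-- The set of points of a region. -/
def Region.carrier (τ : Region) : Set R3 := ⋃ k, τ.cell k '' Icc 0 1

/-- The closed surface that bounds a region, as a set. -/
def Region.surface (τ : Region) : Set R3 := frontier τ.carrier

/-- The normal `n_σ = ∂₁σ × ∂₂σ` of a parametrized surface. -/
def normal (σ : (Fin 2 → ℝ) → R3) (u : Fin 2 → ℝ) : R3 :=
  cross (fderiv ℝ σ u (Pi.single 0 1)) (fderiv ℝ σ u (Pi.single 1 1))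

/-- The function `g_σ(x) = ∫_{[0,1]²} s(x - σ(u)) n_σ(u) d²u` of a parametrized surface `σ`. -/
def patchFun (s : R3 → ℝ) (σ : (Fin 2 → ℝ) → R3) (x : R3) : R3 :=
  ∫ u in Icc (0 : Fin 2 → ℝ) 1, s (x - σ u) • normal σ u

/-- The face `uᵢ = a` of a parametrized cube. -/
def face (τ : (Fin 3 → ℝ) → R3) (i : Fin 3) (a : ℝ) (u : Fin 2 → ℝ) : R3 := τ (i.insertNth a u)

/-- The function `g_σ` of the closed surface `σ = ∂τ`: the sum over the faces of the cubes, with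
their boundary orientation, so that the normal is outward. Common faces of two cubes cancel. -/
def Region.surfaceFun (τ : Region) (s : R3 → ℝ) (x : R3) : R3 :=
  ∑ k, ∑ i : Fin 3, (-1 : ℝ) ^ (i : ℕ) •
    (patchFun s (face (τ.cell k) i 1) x - patchFun s (face (τ.cell k) i 0) x)

/-! ### Contractibility of a region inside a larger one -/

/-- `K` is contained in `U` and can be contracted to a point within `U`. -/
def ContractibleIn (K U : Set R3) : Prop :=
  ∃ h : K ⊆ U, (ContinuousMap.inclusion h).Nullhomotopic

/-- A subset of a contractible subset of `U` can be contracted within `U`. -/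
theorem ContractibleIn.of_subset {K C U : Set R3} (hKC : K ⊆ C) (hCU : C ⊆ U)
    [ContractibleSpace C] : ContractibleIn K U :=
  ⟨hKC.trans hCU, ((id_nullhomotopic C).comp_right (ContinuousMap.inclusion hCU)).comp_left
    (ContinuousMap.inclusion hKC)⟩

end

end GaugeBridge

open GaugeBridge

/-!
The gauge bridge is implemented by a phase. On a gauge invariant observable `A`, conjugation by
`exp(iA(b_ε))` converges to conjugation by multiplication with `exp(iℓ(k))`, where
`ℓ(k) = lim ⟨b_ε, k⟩` exists because `b_ε` is a superposition of pieces of smooth paths.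
Integrating along the whole paths gives `ℓ(grad s') = q (s'(x₂) - s'(x₁))`: the charges at the end
points of the path.

For a region `τ` with boundary `σ`, Gauss' theorem gives `g_σ = -grad (s' * 1_τ)`, and the
smeared indicator `s' * 1_τ` agrees with `1_τ` away from `σ`, which yields the phase `exp(±iq)`.
Off the end points `ℓ` is represented by a field which is divergence free, hence on a set which is
contractible off the charges it is a curl, by Poincaré's homotopy formula.
-/

namespace GaugeBridge

noncomputable section

/-! ### Automorphisms implemented by additive functionals -/

/-- The unitary `(U ψ)(h, k) = e^{iℓ(k)} ψ(h, k)` of an additive functional `ℓ`. For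
`ℓ = ⟨c, ·⟩` it induces the same automorphism of the Weyl algebra as `e^{iA(c)}`, but `ℓ` need not
be given by a test function. -/
def expFunctional (ℓ : VectorTest →+ ℝ) : unitary Op :=
  Unitary.linearIsometryEquiv.symm
    (phasePerm (fun w => Circle.exp (ℓ w.2)) (Equiv.refl (VectorTest × VectorTest)))

@[simp]
theorem expFunctional_apply (ℓ : VectorTest →+ ℝ) (ψ : WeylSpace) (w : VectorTest × VectorTest) :
    (expFunctional ℓ : Op) ψ w = (Circle.exp (ℓ w.2) : ℂ) * ψ w := rfl

theorem expFunctional_zero : expFunctional 0 = 1 := by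
  refine Subtype.ext (ContinuousLinearMap.ext fun ψ => lp.ext (funext fun w => ?_))
  change (expFunctional 0 : Op) ψ w = ψ w
  simp

theorem expFunctional_add (ℓ ℓ' : VectorTest →+ ℝ) :
    expFunctional (ℓ + ℓ') = expFunctional ℓ * expFunctional ℓ' := by
  refine Subtype.ext (ContinuousLinearMap.ext fun ψ => lp.ext (funext fun w => ?_))
  change (expFunctional (ℓ + ℓ') : Op) ψ w = (expFunctional ℓ : Op) ((expFunctional ℓ' : Op) ψ) w
  simp only [expFunctional_apply, AddMonoidHom.add_apply, Circle.exp_add, Circle.coe_mul, mul_assoc]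

theorem expFunctional_mul_expA (ℓ : VectorTest →+ ℝ) (f : VectorTest) :
    (expFunctional ℓ : Op) * expA f = expA f * expFunctional ℓ := by
  refine ContinuousLinearMap.ext fun ψ => lp.ext (funext fun w => ?_)
  change (expFunctional ℓ : Op) ((expA f : Op) ψ) w = (expA f : Op) ((expFunctional ℓ : Op) ψ) w
  simp only [expFunctional_apply, expA_apply]
  ring

theorem expFunctional_mul_expE (ℓ : VectorTest →+ ℝ) (g : VectorTest) :
    (expFunctional ℓ : Op) * expE g =
      Complex.exp (Complex.I * ℓ g) • ((expE g : Op) * expFunctional ℓ) := by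
  refine ContinuousLinearMap.ext fun ψ => lp.ext (funext fun w => ?_)
  change (expFunctional ℓ : Op) ((expE g : Op) ψ) w =
    Complex.exp (Complex.I * ℓ g) * (expE g : Op) ((expFunctional ℓ : Op) ψ) w
  simp only [expFunctional_apply, expE_apply, map_sub, Circle.coe_exp, ← mul_assoc,
    ← Complex.exp_add]
  congr 2
  push_cast
  ring

theorem Ad_apply (U : unitary Op) (a : Op) : Ad U a = U * a * star (U : Op) := rfl

theorem Ad_mul_apply (U V : unitary Op) (a : Op) : Ad (U * V) a = Ad U (Ad V a) :=
  Unitary.conjStarAlgAut_mul_apply U V a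

theorem continuous_Ad (U : unitary Op) : Continuous (Ad U) :=
  (StarAlgEquiv.isometry (Ad U)).continuous

theorem Ad_apply_eq_smul {U : unitary Op} {a : Op} {z : ℂ} (h : (U : Op) * a = z • (a * U)) :
    Ad U a = z • a := by
  rw [Ad_apply, h, smul_mul_assoc, mul_assoc, Unitary.mul_star_self_of_mem U.2, mul_one]

theorem Ad_apply_eq_self {U : unitary Op} {a : Op} (h : (U : Op) * a = a * U) : Ad U a = a := by
  rw [Ad_apply, h, mul_assoc, Unitary.mul_star_self_of_mem U.2, mul_one]

theorem Ad_expFunctional_expA (ℓ : VectorTest →+ ℝ) (f : VectorTest) :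
    Ad (expFunctional ℓ) (expA f) = expA f :=
  Ad_apply_eq_self (expFunctional_mul_expA ℓ f)

theorem Ad_expFunctional_expE (ℓ : VectorTest →+ ℝ) (g : VectorTest) :
    Ad (expFunctional ℓ) (expE g) = Complex.exp (Complex.I * ℓ g) • (expE g : Op) :=
  Ad_apply_eq_smul (expFunctional_mul_expE ℓ g)

theorem Ad_expA_expA (f f' : VectorTest) : Ad (expA f) (expA f') = expA f' := by
  have h : expA f * expA f' = expA f' * expA f := by rw [← expA_add, add_comm, expA_add]
  exact Ad_apply_eq_self (congrArg Subtype.val h)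

theorem Ad_expA_expE (f g : VectorTest) :
    Ad (expA f) (expE g) = Complex.exp (Complex.I * pairing f g) • (expE g : Op) :=
  Ad_apply_eq_smul (expA_mul_expE f g)

theorem Ad_expE_Ad_expFunctional (ℓ : VectorTest →+ ℝ) (g : VectorTest) (a : Op) :
    Ad (expE g) (Ad (expFunctional ℓ) a) = Ad (expFunctional ℓ) (Ad (expE g) a) := by
  set z := Complex.exp (Complex.I * ℓ g) with hz
  have hzz : z * star z = 1 := by
    rw [Complex.star_def, Complex.mul_conj, Complex.normSq_eq_norm_sq, hz, mul_comm,
      Complex.norm_exp_ofReal_mul_I]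
    simp
  have h : ((expFunctional ℓ * expE g : unitary Op) : Op) =
      z • ((expE g * expFunctional ℓ : unitary Op) : Op) := expFunctional_mul_expE ℓ g
  rw [← Ad_mul_apply, ← Ad_mul_apply, Ad_apply, Ad_apply, h, star_smul, smul_mul_assoc,
    smul_mul_assoc, mul_smul_comm, smul_smul, hzz, one_smul]

theorem isClosed_weylAlgebra (O : Set R3) : IsClosed (weylAlgebra O : Set Op) :=
  StarSubalgebra.isClosed_topologicalClosure _

theorem expA_mem_weylAlgebra {O : Set R3} {f : VectorTest} (hf : tsupport f ⊆ O) :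
    (expA f : Op) ∈ weylAlgebra O :=
  StarSubalgebra.le_topologicalClosure _ (StarAlgebra.subset_adjoin ℂ _ (Or.inl ⟨f, hf, rfl⟩))

theorem expE_mem_weylAlgebra {O : Set R3} {g : VectorTest} (hg : tsupport g ⊆ O) :
    (expE g : Op) ∈ weylAlgebra O :=
  (expE_mem_observables hg).1

theorem weylAlgebra_le {O : Set R3} {S : StarSubalgebra ℂ Op} (hS : IsClosed (S : Set Op))
    (hA : ∀ f : VectorTest, tsupport f ⊆ O → (expA f : Op) ∈ S)
    (hE : ∀ g : VectorTest, tsupport g ⊆ O → (expE g : Op) ∈ S) : weylAlgebra O ≤ S := by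
  refine StarSubalgebra.topologicalClosure_minimal (StarAlgebra.adjoin_le ?_) hS
  rintro a (⟨f, hf, rfl⟩ | ⟨g, hg, rfl⟩)
  exacts [hA f hf, hE g hg]

theorem Ad_expFunctional_mem_weylAlgebra (ℓ : VectorTest →+ ℝ) {O : Set R3} {a : Op}
    (ha : a ∈ weylAlgebra O) : Ad (expFunctional ℓ) a ∈ weylAlgebra O := by
  have hle : weylAlgebra O ≤ (weylAlgebra O).comap (Ad (expFunctional ℓ) : Op →⋆ₐ[ℂ] Op) := by
    refine weylAlgebra_le ((isClosed_weylAlgebra O).preimage (continuous_Ad _))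
      (fun f hf => ?_) (fun g hg => ?_)
    · change Ad (expFunctional ℓ) (expA f) ∈ weylAlgebra O
      rw [Ad_expFunctional_expA]
      exact expA_mem_weylAlgebra hf
    · change Ad (expFunctional ℓ) (expE g) ∈ weylAlgebra O
      rw [Ad_expFunctional_expE]
      exact (weylAlgebra O).smul_mem (expE_mem_weylAlgebra hg) _
  exact hle ha

theorem Ad_expFunctional_mem_observables (ℓ : VectorTest →+ ℝ) {O : Set R3} {a : Op}
    (ha : a ∈ observables O) : Ad (expFunctional ℓ) a ∈ observables O :=
  ⟨Ad_expFunctional_mem_weylAlgebra ℓ ha.1, fun s => by rw [Ad_expE_Ad_expFunctional, ha.2 s]⟩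

/-- The `*`-endomorphism of `𝔄(O)` implemented by the unitary of an additive functional. -/
def functionalHom (ℓ : VectorTest →+ ℝ) (O : Set R3) : observables O →⋆ₐ[ℂ] observables O :=
  StarAlgHom.codRestrict ((Ad (expFunctional ℓ) : Op →⋆ₐ[ℂ] Op).comp (observables O).subtype)
    (observables O) fun a => Ad_expFunctional_mem_observables ℓ a.2

theorem functionalHom_comp_of_add_eq_zero {ℓ ℓ' : VectorTest →+ ℝ} (h : ℓ + ℓ' = 0) (O : Set R3) :
    (functionalHom ℓ O).comp (functionalHom ℓ' O) = StarAlgHom.id ℂ (observables O) := by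
  refine StarAlgHom.ext fun a => Subtype.ext ?_
  change Ad (expFunctional ℓ) (Ad (expFunctional ℓ') a) = a
  rw [← Ad_mul_apply, ← expFunctional_add, h, expFunctional_zero]
  exact Ad_apply_eq_self (by simp)

/-- The `*`-automorphism of `𝔄(O)` implemented by the unitary of an additive functional. -/
def functionalAut (ℓ : VectorTest →+ ℝ) (O : Set R3) : observables O ≃⋆ₐ[ℂ] observables O :=
  StarAlgEquiv.ofStarAlgHom (functionalHom ℓ O) (functionalHom (-ℓ) O)
    (functionalHom_comp_of_add_eq_zero (neg_add_cancel ℓ) O)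
    (functionalHom_comp_of_add_eq_zero (add_neg_cancel ℓ) O)

theorem coe_functionalAut (ℓ : VectorTest →+ ℝ) (O : Set R3) (a : observables O) :
    (functionalAut ℓ O a : Op) = Ad (expFunctional ℓ) a := rfl

theorem functionalAut_obsE (ℓ : VectorTest →+ ℝ) {O : Set R3} {g : VectorTest}
    (hg : tsupport g ⊆ O) :
    functionalAut ℓ O (obsE O g hg) = Complex.exp (Complex.I * ℓ g) • obsE O g hg :=
  Subtype.ext (Ad_expFunctional_expE ℓ g)

theorem functionalAut_obsDivE {ℓ : VectorTest →+ ℝ} {O : Set R3} {s : ScalarTest}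
    (hs : tsupport s ⊆ O) (h : ℓ (grad s) = 0) :
    functionalAut ℓ O (obsDivE O s hs) = obsDivE O s hs := by
  have key := functionalAut_obsE ℓ (tsupport_neg_grad_subset hs)
  rwa [map_neg, h, neg_zero, Complex.ofReal_zero, mul_zero, Complex.exp_zero, one_smul] at key

theorem Ad_expFunctional_eq_Ad_expA {ℓ : VectorTest →+ ℝ} {c : VectorTest} {O : Set R3}
    (h : ∀ g : VectorTest, tsupport g ⊆ O → ℓ g = pairing c g) {a : Op} (ha : a ∈ weylAlgebra O) :
    Ad (expFunctional ℓ) a = Ad (expA c) a := by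
  have hle : weylAlgebra O ≤ StarAlgHom.equalizer (Ad (expFunctional ℓ)) (Ad (expA c)) := by
    refine weylAlgebra_le (isClosed_eq (continuous_Ad _) (continuous_Ad _))
      (fun f _ => ?_) (fun g hg => ?_)
    · change Ad (expFunctional ℓ) (expA f) = Ad (expA c) (expA f)
      rw [Ad_expFunctional_expA, Ad_expA_expA]
    · change Ad (expFunctional ℓ) (expE g) = Ad (expA c) (expE g)
      rw [Ad_expFunctional_expE, Ad_expA_expE, h g hg]
  exact hle ha

/-- The elements on which the `*`-homomorphisms `φ i` converge to `ψ`. -/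
def convergenceSubalgebra {ι R A B : Type*} [CommSemiring R] [StarRing R] [Semiring A] [StarRing A]
    [Algebra R A] [StarModule R A] [Semiring B] [StarRing B] [Algebra R B] [TopologicalSpace B]
    [IsTopologicalSemiring B] [ContinuousStar B] (l : Filter ι) (φ : ι → A →⋆ₐ[R] B)
    (ψ : A →⋆ₐ[R] B) : StarSubalgebra R A where
  carrier := {a | Tendsto (fun i => φ i a) l (𝓝 (ψ a))}
  mul_mem' ha hb := by simpa only [mem_ofPred, map_mul] using! Tendsto.mul ha hb
  add_mem' ha hb := by simpa only [mem_ofPred, map_add] using! Tendsto.add ha hb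
  algebraMap_mem' r := by
    simpa only [mem_ofPred, AlgHomClass.commutes] using! tendsto_const_nhds
  star_mem' ha := by simpa only [mem_ofPred, map_star] using! Tendsto.star ha

theorem tendsto_Ad_expA {ι : Type*} {l : Filter ι} {b : ι → VectorTest} {ℓ : VectorTest →+ ℝ}
    (h : ∀ g, Tendsto (fun i => pairing (b i) g) l (𝓝 (ℓ g))) {O : Set R3} {a : Op}
    (ha : a ∈ weylAlgebra O) :
    Tendsto (fun i => Ad (expA (b i)) a) l (𝓝 (Ad (expFunctional ℓ) a)) := by
  have hequi : Equicontinuous fun i => ⇑(Ad (expA (b i))) :=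
    (LipschitzWith.uniformEquicontinuous _ 1 fun i =>
      (StarAlgEquiv.isometry (Ad (expA (b i)))).lipschitz).equicontinuous
  have hle : weylAlgebra O ≤ convergenceSubalgebra l
      (fun i => (Ad (expA (b i)) : Op →⋆ₐ[ℂ] Op)) (Ad (expFunctional ℓ)) := by
    refine weylAlgebra_le (hequi.isClosed_setOfPred_tendsto (continuous_Ad _))
      (fun f _ => ?_) (fun g _ => ?_)
    · change Tendsto (fun i => Ad (expA (b i)) (expA f)) l (𝓝 (Ad (expFunctional ℓ) (expA f)))
      simp only [Ad_expA_expA, Ad_expFunctional_expA]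
      exact tendsto_const_nhds
    · change Tendsto (fun i => Ad (expA (b i)) (expE g)) l (𝓝 (Ad (expFunctional ℓ) (expE g)))
      simp only [Ad_expA_expE, Ad_expFunctional_expE]
      have hexp : Continuous fun t : ℝ => Complex.exp (Complex.I * t) := by fun_prop
      exact ((hexp.tendsto (ℓ g)).comp (h g)).smul_const _
  exact hle ha

/-! ### Integrals depending on a parameter -/

section ParametricIntegral

universe u

variable {E : Type u} [NormedAddCommGroup E] [NormedSpace ℝ E] [FiniteDimensional ℝ E]

theorem hasFDerivAt_intervalIntegral_of_contDiff {G : Type*} [NormedAddCommGroup G]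
    [NormedSpace ℝ G] {F : ℝ × E → G} (hF : ContDiff ℝ 1 F) (a b : ℝ) (x : E) :
    HasFDerivAt (fun x => ∫ u in a..b, F (u, x))
      (∫ u in a..b, (fderiv ℝ F (u, x)).comp (ContinuousLinearMap.inr ℝ ℝ E)) x := by
  have hF' : Continuous fun p : ℝ × E => (fderiv ℝ F p).comp (ContinuousLinearMap.inr ℝ ℝ E) :=
    (hF.continuous_fderiv one_ne_zero).clm_comp continuous_const
  obtain ⟨C, hC⟩ := (isCompact_uIcc.prod (isCompact_closedBall x 1)).exists_bound_of_continuousOn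
    (s := uIcc a b ×ˢ Metric.closedBall x 1) hF'.continuousOn
  refine intervalIntegral.hasFDerivAt_integral_of_dominated_of_fderiv_le
    (F := fun x u => F (u, x))
    (F' := fun x u => (fderiv ℝ F (u, x)).comp (ContinuousLinearMap.inr ℝ ℝ E))
    (bound := fun _ => C) (Metric.closedBall_mem_nhds x one_pos) ?_ ?_ ?_ ?_ ?_ ?_
  · exact .of_forall fun y => (hF.continuous.comp (.prodMk_left y)).aestronglyMeasurable
  · exact (hF.continuous.comp (.prodMk_left x)).intervalIntegrable a b
  · exact (hF'.comp (.prodMk_left x)).aestronglyMeasurable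
  · exact .of_forall fun u hu y hy => hC (u, y) ⟨uIoc_subset_uIcc hu, hy⟩
  · exact intervalIntegrable_const
  · exact .of_forall fun u _ y _ =>
      ((hF.differentiable one_ne_zero).differentiableAt.hasFDerivAt).comp y
        (hasFDerivAt_prodMk_right u y)

theorem contDiff_intervalIntegral {G : Type u} [NormedAddCommGroup G] [NormedSpace ℝ G] {n : ℕ∞}
    {F : ℝ × E → G} (hF : ContDiff ℝ n F) (a b : ℝ) :
    ContDiff ℝ n fun x => ∫ u in a..b, F (u, x) := by
  refine contDiff_iff_forall_nat_le.2 fun m hm => ?_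
  replace hF : ContDiff ℝ m F := hF.of_le (mod_cast hm)
  clear hm
  induction m generalizing G with
  | zero =>
    exact contDiff_zero.2
      (intervalIntegral.continuous_parametric_intervalIntegral_of_continuous'
        (f := fun x u => F (u, x)) (hF.continuous.comp continuous_swap) a b)
  | succ m ih =>
    have h := hasFDerivAt_intervalIntegral_of_contDiff (hF.of_le (m := 1) (by simp)) a b
    rw [Nat.cast_succ] at hF ⊢
    refine contDiff_succ_iff_fderiv.2 ⟨fun x => (h x).differentiableAt, by simp, ?_⟩
    rw [funext fun x => (h x).fderiv]
    exact ih (F := fun p => (fderiv ℝ F p).comp (ContinuousLinearMap.inr ℝ ℝ E))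
      ((hF.fderiv_right le_rfl).clm_comp contDiff_const)

end ParametricIntegral

theorem intervalIntegral_integral_swap_of_continuousOn {Y E : Type*} [TopologicalSpace Y]
    [T2Space Y] [SecondCountableTopology Y] [MeasurableSpace Y] [BorelSpace Y]
    [NormedAddCommGroup E] [NormedSpace ℝ E] {μ : Measure Y} [SFinite μ]
    [IsFiniteMeasureOnCompacts μ] {a b : ℝ} {f : ℝ → Y → E} {K : Set Y} (hK : IsCompact K)
    (hf : ContinuousOn f.uncurry (uIcc a b ×ˢ univ)) (h0 : ∀ u ∈ uIcc a b, ∀ y ∉ K, f u y = 0) :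
    ∫ u in a..b, ∫ y, f u y ∂μ = ∫ y, (∫ u in a..b, f u y) ∂μ := by
  refine intervalIntegral_integral_swap ?_
  have hcompact : IntegrableOn f.uncurry (uIcc a b ×ˢ K) (volume.prod μ) :=
    (hf.mono (prod_mono_right (subset_univ K))).integrableOn_compact (isCompact_uIcc.prod hK)
  have hslab : IntegrableOn f.uncurry (uIoc a b ×ˢ univ) (volume.prod μ) := by
    refine hcompact.of_forall_sdiff_eq_zero (measurableSet_uIoc.prod .univ) fun p hp => ?_
    exact h0 _ (uIoc_subset_uIcc hp.1.1) _ fun hpK => hp.2 ⟨uIoc_subset_uIcc hp.1.1, hpK⟩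
  rwa [IntegrableOn, ← Measure.prod_restrict, Measure.restrict_univ] at hslab

/-! ### Vector calculus -/

/-- The vector product as a continuous bilinear map. -/
def crossCLM : R3 →L[ℝ] R3 →L[ℝ] R3 :=
  LinearMap.toContinuousBilinearMap
    ((crossProduct (R := ℝ)).compl₁₂ (WithLp.linearEquiv 2 ℝ (Fin 3 → ℝ)).toLinearMap
      (WithLp.linearEquiv 2 ℝ (Fin 3 → ℝ)).toLinearMap |>.compr₂
        (WithLp.linearEquiv 2 ℝ (Fin 3 → ℝ)).symm.toLinearMap)

theorem crossCLM_apply (a b : R3) : crossCLM a b = cross a b := rfl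

theorem inner_cross (a b c : R3) : inner ℝ a (cross b c) =
    a 0 * (b 1 * c 2 - b 2 * c 1) + a 1 * (b 2 * c 0 - b 0 * c 2) +
      a 2 * (b 0 * c 1 - b 1 * c 0) := by
  simp [cross, cross_apply, PiLp.inner_apply, Fin.sum_univ_three]
  ring

/-- The divergence `∂₀B₀ + ∂₁B₁ + ∂₂B₂` of a vector field. -/
def divFun (B : R3 → R3) (x : R3) : ℝ := ∑ i, partialDeriv B i i x

theorem clm_apply_eq_sum {ι F : Type*} [Fintype ι] [DecidableEq ι] [NormedAddCommGroup F]
    [NormedSpace ℝ F] (L : EuclideanSpace ℝ ι →L[ℝ] F) (a : EuclideanSpace ℝ ι) :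
    L a = ∑ j, a j • L (EuclideanSpace.single j 1) := by
  conv_lhs => rw [← (EuclideanSpace.basisFun ι ℝ).sum_repr a, map_sum]
  simp

section Pullback

variable {E : Type*} [NormedAddCommGroup E] [NormedSpace ℝ E]

/-- The value at `(v, w)` of the pullback along `G` of the flux `2`-form of `B`, that is,
`B(G(x)) · (∂_v G(x) × ∂_w G(x))`. -/
def pullback (B : R3 → R3) (G : E → R3) (v w x : E) : ℝ :=
  inner ℝ (B (G x)) (cross (fderiv ℝ G x v) (fderiv ℝ G x w))

theorem contDiff_pullback {n : WithTop ℕ∞} {B : R3 → R3} {G : E → R3} (hB : ContDiff ℝ n B)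
    (hG : ContDiff ℝ (n + 1) G) (v w : E) : ContDiff ℝ n (pullback B G v w) := by
  have hG' : ContDiff ℝ n (fderiv ℝ G) := hG.fderiv_right le_rfl
  exact (hB.comp (hG.of_le le_self_add)).inner ℝ
    ((crossCLM.contDiff.comp (hG'.clm_apply contDiff_const)).clm_apply
      (hG'.clm_apply contDiff_const))

theorem fderiv_pullback_apply {B : R3 → R3} {G : E → R3} {x : E}
    (hB : DifferentiableAt ℝ B (G x)) (hG : ContDiffAt ℝ 2 G x) (v w u : E) :
    fderiv ℝ (pullback B G v w) x u =
      inner ℝ (fderiv ℝ B (G x) (fderiv ℝ G x u)) (cross (fderiv ℝ G x v) (fderiv ℝ G x w)) +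
      inner ℝ (B (G x)) (cross (fderiv ℝ (fderiv ℝ G) x u v) (fderiv ℝ G x w)) +
      inner ℝ (B (G x)) (cross (fderiv ℝ G x v) (fderiv ℝ (fderiv ℝ G) x u w)) := by
  have hBG : HasFDerivAt (fun y => B (G y)) ((fderiv ℝ B (G x)).comp (fderiv ℝ G x)) x :=
    hB.hasFDerivAt.comp x (hG.differentiableAt two_ne_zero).hasFDerivAt
  have hG' : DifferentiableAt ℝ (fderiv ℝ G) x :=
    (hG.fderiv_right (m := 1) (by norm_num)).differentiableAt one_ne_zero
  have hGv (v : E) : HasFDerivAt (fun y => fderiv ℝ G y v)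
      ((fderiv ℝ (fderiv ℝ G) x).flip v) x := by
    simpa using hG'.hasFDerivAt.clm_apply (hasFDerivAt_const v x)
  have h := hBG.inner ℝ (crossCLM.hasFDerivAt_of_bilinear (hGv v) (hGv w))
  rw [show pullback B G v w = fun t => inner ℝ (B (G t))
    (crossCLM (fderiv ℝ G t v) (fderiv ℝ G t w)) from rfl, h.fderiv]
  simp only [ContinuousLinearMap.comp_apply, ContinuousLinearMap.prod_apply, fderivInnerCLM_apply,
    _root_.add_apply, ContinuousLinearMap.precompR_apply, ContinuousLinearMap.compL_apply,
    ContinuousLinearMap.precompL_apply, ContinuousLinearMap.flip_apply, crossCLM_apply,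
    inner_add_right]
  ring

/-- The exterior derivative of the pulled back `2`-form is the pullback of `(div B) dx`. -/
theorem fderiv_pullback_cyclic {B : R3 → R3} {G : E → R3} {x : E}
    (hB : DifferentiableAt ℝ B (G x)) (hG : ContDiffAt ℝ 2 G x) (u v w : E) :
    fderiv ℝ (pullback B G v w) x u + fderiv ℝ (pullback B G w u) x v +
      fderiv ℝ (pullback B G u v) x w =
    divFun B (G x) * inner ℝ (fderiv ℝ G x u) (cross (fderiv ℝ G x v) (fderiv ℝ G x w)) := by
  have hs : IsSymmSndFDerivAt ℝ G x := hG.isSymmSndFDerivAt (by simp)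
  rw [fderiv_pullback_apply hB hG, fderiv_pullback_apply hB hG, fderiv_pullback_apply hB hG,
    hs.eq v u, hs.eq w u, hs.eq w v]
  have hcoord (a : E) (i : Fin 3) : fderiv ℝ B (G x) (fderiv ℝ G x a) i =
      ∑ j, fderiv ℝ G x a j * fderiv ℝ B (G x) (EuclideanSpace.single j 1) i := by
    rw [clm_apply_eq_sum (fderiv ℝ B (G x))]
    simp
  simp only [inner_cross, hcoord, divFun, partialDeriv, Fin.sum_univ_three]
  ring

end Pullback

/-! ### Smooth cutoffs -/

theorem exists_contDiff_eventuallyEq_nhdsSet {E F : Type*} [NormedAddCommGroup E]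
    [NormedSpace ℝ E] [FiniteDimensional ℝ E] [NormedAddCommGroup F] [NormedSpace ℝ F] {n : ℕ∞}
    {f : E → F} {K U : Set E} (hK : IsClosed K) (hU : IsOpen U) (hKU : K ⊆ U)
    (hf : ContDiffOn ℝ n f U) :
    ∃ g : E → F, ContDiff ℝ n g ∧ tsupport g ⊆ U ∧ g =ᶠ[𝓝ˢ K] f := by
  obtain ⟨V, hV, hKV, hVU⟩ := normal_exists_closure_subset hK hU hKU
  obtain ⟨χ, hχK, hχV, -⟩ := exists_contMDiffMap_one_nhds_of_subset_interior (n := n)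
    (I := modelWithCornersSelf ℝ E) hK (hKV.trans (hV.subset_interior_iff.2 subset_closure))
  have hχ : tsupport χ ⊆ U :=
    (closure_minimal (fun x hx => not_imp_comm.1 (hχV x) hx) isClosed_closure).trans hVU
  refine ⟨fun x => χ x • f x, contDiff_iff_contDiffAt.2 fun x => ?_,
    (tsupport_smul_subset_left χ f).trans hχ, ?_⟩
  · by_cases hx : x ∈ tsupport χ
    · exact χ.contMDiff.contDiff.contDiffAt.smul (hf.contDiffAt (hU.mem_nhds (hχ hx)))
    · refine (contDiffAt_const (c := (0 : F))).congr_of_eventuallyEq ?_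
      filter_upwards [(isClosed_tsupport χ).isOpen_compl.mem_nhds hx] with y hy
      rw [image_eq_zero_of_notMem_tsupport hy, zero_smul]
  · filter_upwards [hχK] with x hx
    rw [hx, one_smul]

/-! ### The flux along neighbouring paths -/

section Bridge

variable {γ : ℝ → R3} (hγ : ContDiffOn ℝ ∞ γ (Icc 0 1))

/-- The velocity of the neighbouring path `γ_y` at a time `u ∈ [0,1]`, including the end points. -/
def nbrVelocity (γ : ℝ → R3) (y : R3) (u : ℝ) : R3 :=
  derivWithin γ (Icc 0 1) u + (1 - 2 * u) • y

include hγ in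
theorem hasDerivAt_nbrPath {u : ℝ} (hu : u ∈ Ioo (0 : ℝ) 1) (y : R3) :
    HasDerivAt (nbrPath γ y) (nbrVelocity γ y u) u := by
  have h1 : HasDerivAt γ (derivWithin γ (Icc 0 1) u) u :=
    ((hγ.differentiableOn (by simp)) u (Ioo_subset_Icc_self hu)).hasDerivWithinAt.hasDerivAt
      (Icc_mem_nhds hu.1 hu.2)
  have h2 : HasDerivAt (fun u : ℝ => u * (1 - u)) (1 - 2 * u) u :=
    ((hasDerivAt_id u).mul ((hasDerivAt_id u).const_sub 1)).congr_deriv (by simp; ring)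
  exact h1.add (h2.smul_const y)

include hγ in
theorem continuousOn_nbrPath :
    ContinuousOn (fun p : ℝ × R3 => nbrPath γ p.2 p.1) (Icc 0 1 ×ˢ univ) :=
  (hγ.continuousOn.comp continuousOn_fst fun _ hp => hp.1).add (by fun_prop)

include hγ in
theorem continuousOn_nbrVelocity :
    ContinuousOn (fun p : ℝ × R3 => nbrVelocity γ p.2 p.1) (Icc 0 1 ×ˢ univ) :=
  ((hγ.continuousOn_derivWithin (uniqueDiffOn_Icc zero_lt_one) (by simp)).comp continuousOn_fst
    fun _ hp => hp.1).add (by fun_prop)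

/-- The integrand `s(y) γ_y'(u) · g(γ_y(u))` of the flux. -/
def fluxDensity (γ : ℝ → R3) (s : R3 → ℝ) (g : R3 → R3) (u : ℝ) (y : R3) : ℝ :=
  s y * inner ℝ (nbrVelocity γ y u) (g (nbrPath γ y u))

/-- The pairing `⟨a_u, g⟩ = ∫ s(y) γ_y'(u) · g(γ_y(u)) dy`, which also makes sense at the end points
`u = 0` and `u = 1`. -/
def flux (γ : ℝ → R3) (s : R3 → ℝ) (g : R3 → R3) (u : ℝ) : ℝ := ∫ y, fluxDensity γ s g u y

theorem fluxDensity_eq_zero {s : R3 → ℝ} {y : R3} (hy : y ∉ tsupport s) (g : R3 → R3) (u : ℝ) :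
    fluxDensity γ s g u y = 0 := by
  rw [fluxDensity, image_eq_zero_of_notMem_tsupport hy, zero_mul]

theorem flux_eq_zero {s : R3 → ℝ} {g : R3 → R3} {u : ℝ}
    (h : ∀ y ∈ tsupport s, g (nbrPath γ y u) = 0) : flux γ s g u = 0 := by
  refine integral_eq_zero_of_ae (.of_forall fun y => ?_)
  by_cases hy : y ∈ tsupport s
  · rw [fluxDensity, h y hy, inner_zero_right, mul_zero, Pi.zero_apply]
  · exact fluxDensity_eq_zero hy g u

include hγ in
theorem continuousOn_fluxDensity {s : R3 → ℝ} (hs : Continuous s) {g : R3 → R3}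
    (hg : Continuous g) : ContinuousOn (fluxDensity γ s g).uncurry (Icc 0 1 ×ˢ univ) :=
  (hs.comp continuous_snd).continuousOn.mul
    ((continuousOn_nbrVelocity hγ).inner (hg.comp_continuousOn (continuousOn_nbrPath hγ)))

include hγ in
theorem continuousOn_flux (s : ScalarTest) {g : R3 → R3} (hg : Continuous g) :
    ContinuousOn (flux γ s g) (Icc 0 1) :=
  continuousOn_integral_of_compact_support s.hasCompactSupport
    (continuousOn_fluxDensity hγ s.continuous hg) fun u _ _ hy => fluxDensity_eq_zero hy g u

include hγ in
theorem intervalIntegrable_flux (s : ScalarTest) {g : R3 → R3} (hg : Continuous g) {a b : ℝ}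
    (ha : a ∈ Icc (0 : ℝ) 1) (hb : b ∈ Icc (0 : ℝ) 1) :
    IntervalIntegrable (flux γ s g) volume a b :=
  ((continuousOn_flux hγ s hg).mono (uIcc_subset_Icc ha hb)).intervalIntegrable

include hγ in
theorem flux_add (s : ScalarTest) {g g' : R3 → R3} (hg : Continuous g) (hg' : Continuous g')
    {u : ℝ} (hu : u ∈ Icc (0 : ℝ) 1) : flux γ s (g + g') u = flux γ s g u + flux γ s g' u := by
  have hi {g : R3 → R3} (hg : Continuous g) : Integrable (fluxDensity γ s g u) :=
    ((continuousOn_fluxDensity hγ s.continuous hg).comp_continuous (.prodMk_right u)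
      fun _ => ⟨hu, trivial⟩).integrable_of_hasCompactSupport
        (.intro s.hasCompactSupport fun _ hy => fluxDensity_eq_zero hy g u)
  rw [flux, flux, flux, ← integral_add (hi hg) (hi hg')]
  refine integral_congr_ae (.of_forall fun y => ?_)
  simp only [fluxDensity, Pi.add_apply, inner_add_right, mul_add]

include hγ in
theorem integral_fluxDensity_grad (s : R3 → ℝ) (hs : Continuous s) (s' : ScalarTest) (y : R3) :
    ∫ u in (0 : ℝ)..1, fluxDensity γ s (grad s') u y = s y * (s' (γ 1) - s' (γ 0)) := by
  have hslice : ContinuousOn (fun u : ℝ => (u, y)) (Icc 0 1) := by fun_prop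
  have hmaps : MapsTo (fun u : ℝ => (u, y)) (Icc 0 1) (Icc 0 1 ×ˢ univ) := fun u hu => ⟨hu, trivial⟩
  have hderiv (u : ℝ) (hu : u ∈ Ioo (0 : ℝ) 1) :
      HasDerivAt (fun u => s y * s' (nbrPath γ y u)) (fluxDensity γ s (grad s') u y) u := by
    have hd := (s'.contDiff.differentiable (by simp)) (nbrPath γ y u)
    refine ((hd.hasFDerivAt.comp_hasDerivAt u (hasDerivAt_nbrPath hγ hu y)).const_mul
      (s y)).congr_deriv ?_
    change _ = s y * inner ℝ (nbrVelocity γ y u) (gradient s' (nbrPath γ y u))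
    rw [real_inner_comm, gradient, InnerProductSpace.toDual_symm_apply]
  rw [intervalIntegral.integral_eq_sub_of_hasDerivAt_of_le zero_le_one
    (((s'.continuous.comp_continuousOn (continuousOn_nbrPath hγ)).comp hslice hmaps).const_mul
      (s y)) hderiv]
  · simp [nbrPath, mul_sub]
  · refine ContinuousOn.intervalIntegrable ?_
    rw [uIcc_of_le zero_le_one]
    exact (continuousOn_fluxDensity hγ hs (grad s').continuous).comp hslice hmaps

/-! ### The gauge bridge functional -/

/-- The functional `g ↦ lim ⟨b_ε, g⟩`, written as the integral of the flux over the full paths. -/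
def bridgeFunctional (s : ScalarTest) : VectorTest →+ ℝ :=
  AddMonoidHom.mk' (fun g => ∫ u in (0 : ℝ)..1, flux γ s g u) fun g g' => by
    have h0 : (0 : ℝ) ∈ Icc (0 : ℝ) 1 := by simp
    have h1 : (1 : ℝ) ∈ Icc (0 : ℝ) 1 := by simp
    rw [← intervalIntegral.integral_add (intervalIntegrable_flux hγ s g.continuous h0 h1)
      (intervalIntegrable_flux hγ s g'.continuous h0 h1)]
    refine intervalIntegral.integral_congr fun u hu => ?_
    rw [uIcc_of_le zero_le_one] at hu
    exact flux_add hγ s g.continuous g'.continuous hu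

theorem bridgeFunctional_apply (s : ScalarTest) (g : VectorTest) :
    bridgeFunctional hγ s g = ∫ u in (0 : ℝ)..1, flux γ s g u := rfl

theorem bridgeFunctional_grad (s s' : ScalarTest) :
    bridgeFunctional hγ s (grad s') = (∫ y, s y) * (s' (γ 1) - s' (γ 0)) := by
  have hc := continuousOn_fluxDensity hγ s.continuous (grad s').continuous
  rw [← uIcc_of_le (zero_le_one' ℝ)] at hc
  rw [bridgeFunctional_apply, ← integral_mul_const]
  simp only [flux]
  rw [intervalIntegral_integral_swap_of_continuousOn s.hasCompactSupport hc
    fun u _ _ hy => fluxDensity_eq_zero hy _ u]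
  exact integral_congr_ae
    (.of_forall fun y => integral_fluxDensity_grad hγ s s.continuous s' y)

theorem tendsto_integral_flux (s : ScalarTest) (g : VectorTest) :
    Tendsto (fun ε : ℝ => ∫ u in ε..(1 - ε), flux γ s g u) (𝓝[>] 0)
      (𝓝 (bridgeFunctional hγ s g)) := by
  have h0 : (0 : ℝ) ∈ Icc (0 : ℝ) 1 := by simp
  have h1 : (1 : ℝ) ∈ Icc (0 : ℝ) 1 := by simp
  have hi {a b : ℝ} (ha : a ∈ Icc (0 : ℝ) 1) (hb : b ∈ Icc (0 : ℝ) 1) :=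
    intervalIntegrable_flux hγ s g.continuous ha hb
  have hp : ContinuousOn (fun t => ∫ u in (0 : ℝ)..t, flux γ s g u) (Icc 0 1) := by
    have h := intervalIntegral.continuousOn_primitive_interval' (hi h0 h1) left_mem_uIcc
    rwa [uIcc_of_le zero_le_one] at h
  have hsub {ε : ℝ} (hε : ε ∈ Icc (0 : ℝ) 1) : 1 - ε ∈ Icc (0 : ℝ) 1 := by
    constructor <;> linarith [hε.1, hε.2]
  have hc : ContinuousOn (fun ε : ℝ => ∫ u in ε..(1 - ε), flux γ s g u) (Icc 0 1) := by
    refine ((hp.comp (by fun_prop) fun ε hε => hsub hε).sub hp).congr fun ε hε => ?_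
    exact (intervalIntegral.integral_interval_sub_left (hi h0 (hsub hε)) (hi h0 hε)).symm
  have h := (hc 0 h0).tendsto
  rw [sub_zero] at h
  refine h.mono_left (nhdsWithin_le_of_mem ?_)
  exact mem_of_superset (Ioo_mem_nhdsGT one_pos) Ioo_subset_Icc_self

/-! ### The test functions of the bridge -/

include hγ in
theorem integral_inner_bridgeDensity (s : R3 → ℝ) (g : R3 → R3) {u : ℝ}
    (hu : u ∈ Ioo (0 : ℝ) 1) :
    ∫ x, inner ℝ (bridgeDensity γ s u x) (g x) = flux γ s g u := by
  simp only [integral_bridgeDensity γ s hu g, flux, fluxDensity, (hasDerivAt_nbrPath hγ hu _).deriv]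

include hγ in
theorem contDiffOn_bridgeDensity {s : R3 → ℝ} (hs : ContDiff ℝ ∞ s) :
    ContDiffOn ℝ ∞ (fun p : ℝ × R3 => bridgeDensity γ s p.1 p.2) (Ioo 0 1 ×ˢ univ) := by
  have hmaps : MapsTo Prod.fst (Ioo (0 : ℝ) 1 ×ˢ (univ : Set R3)) (Icc 0 1) :=
    fun _ hp => Ioo_subset_Icc_self hp.1
  have hpath := hγ.comp (contDiff_fst (𝕜 := ℝ)).contDiffOn hmaps
  have hvel := (hγ.derivWithin (uniqueDiffOn_Icc zero_lt_one) (m := ∞) le_rfl).comp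
    (contDiff_fst (𝕜 := ℝ)).contDiffOn hmaps
  have hne (p : ℝ × R3) (hp : p ∈ Ioo (0 : ℝ) 1 ×ˢ univ) : p.1 * (1 - p.1) ≠ 0 :=
    (mul_pos hp.1.1 (sub_pos.2 hp.1.2)).ne'
  have hpoly : ContDiff ℝ ∞ fun p : ℝ × R3 => p.1 * (1 - p.1) := by fun_prop
  have hy := (hpoly.contDiffOn.inv hne).smul (contDiff_snd.contDiffOn.sub hpath)
  have hfactor : ContDiff ℝ ∞ fun p : ℝ × R3 => 1 - 2 * p.1 := by fun_prop
  refine ((((hpoly.pow 3).contDiffOn.inv fun p hp => pow_ne_zero 3 (hne p hp)).mul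
    (hs.comp_contDiffOn hy)).smul (hvel.add (hfactor.contDiffOn.smul hy))).congr fun p hp => ?_
  simp only [bridgeDensity, (hasDerivAt_nbrPath hγ hp.1 _).deriv]
  rfl

theorem Icc_subset_Ioo_of_mem {ε : ℝ} (hε : 0 < ε) : Icc ε (1 - ε) ⊆ Ioo 0 1 :=
  Icc_subset_Ioo hε (by linarith)

theorem uIcc_one_sub {ε : ℝ} (hε : ε ≤ 1 / 2) : uIcc ε (1 - ε) = Icc ε (1 - ε) :=
  uIcc_of_le (by linarith)

include hγ in
theorem contDiff_bridgeFun {s : R3 → ℝ} (hs : ContDiff ℝ ∞ s) {ε : ℝ}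
    (hε : ε ∈ Ioo (0 : ℝ) (1 / 2)) : ContDiff ℝ ∞ (bridgeFun γ s ε) := by
  obtain ⟨F, hF, -, hFeq⟩ := exists_contDiff_eventuallyEq_nhdsSet
    (isClosed_Icc.prod isClosed_univ) (isOpen_Ioo.prod isOpen_univ)
    (prod_mono_left (Icc_subset_Ioo_of_mem hε.1)) (contDiffOn_bridgeDensity hγ hs)
  have h : bridgeFun γ s ε = fun x => ∫ u in ε..(1 - ε), F (u, x) := by
    refine funext fun x => intervalIntegral.integral_congr fun u hu => ?_
    rw [uIcc_one_sub hε.2.le] at hu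
    exact (hFeq.self_of_nhdsSet (x := (u, x)) ⟨hu, trivial⟩).symm
  exact h ▸ contDiff_intervalIntegral hF ε (1 - ε)

include hγ in
theorem integral_inner_bridgeFun {s : R3 → ℝ} (hs : ContDiff ℝ ∞ s) (g : VectorTest) {ε : ℝ}
    (hε : ε ∈ Ioo (0 : ℝ) (1 / 2)) :
    ∫ x, inner ℝ (bridgeFun γ s ε x) (g x) = ∫ u in ε..(1 - ε), flux γ s g u := by
  have hsub : uIcc ε (1 - ε) ⊆ Ioo 0 1 := by
    rw [uIcc_one_sub hε.2.le]
    exact Icc_subset_Ioo_of_mem hε.1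
  have hc := (contDiffOn_bridgeDensity hγ hs).continuousOn.mono
    (prod_mono_left (t := (univ : Set R3)) hsub)
  have hx (x : R3) : ∫ u in ε..(1 - ε), inner ℝ (bridgeDensity γ s u x) (g x) =
      inner ℝ (bridgeFun γ s ε x) (g x) := by
    have hi : IntervalIntegrable (fun u => bridgeDensity γ s u x) volume ε (1 - ε) :=
      (hc.comp (f := fun u => (u, x)) (by fun_prop) fun u hu => ⟨hu, trivial⟩).intervalIntegrable
    simp only [real_inner_comm (g x)]
    exact (innerSL ℝ (g x)).intervalIntegral_comp_comm hi
  simp only [← hx]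
  rw [← intervalIntegral_integral_swap_of_continuousOn g.hasCompactSupport
    (hc.inner (by fun_prop)) fun u _ x hxg => by
      rw [image_eq_zero_of_notMem_tsupport hxg, inner_zero_right]]
  exact intervalIntegral.integral_congr fun u hu => integral_inner_bridgeDensity hγ s g (hsub hu)

/-- The points of the neighbouring paths on `[ε, 1 - ε]` that carry `b_ε`. -/
def bridgeSupport (γ : ℝ → R3) (s : R3 → ℝ) (ε : ℝ) : Set R3 :=
  (fun p : ℝ × R3 => nbrPath γ p.2 p.1) '' (Icc ε (1 - ε) ×ˢ tsupport s)

include hγ in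
theorem isCompact_bridgeSupport {s : R3 → ℝ} (hs : HasCompactSupport s) {ε : ℝ} (hε : 0 < ε) :
    IsCompact (bridgeSupport γ s ε) :=
  (isCompact_Icc.prod hs).image_of_continuousOn ((continuousOn_nbrPath hγ).mono
    (prod_mono ((Icc_subset_Ioo_of_mem hε).trans Ioo_subset_Icc_self) (subset_univ _)))

include hγ in
theorem tsupport_bridgeFun_subset {s : R3 → ℝ} (hs : HasCompactSupport s) {ε : ℝ}
    (hε : ε ∈ Ioo (0 : ℝ) (1 / 2)) : tsupport (bridgeFun γ s ε) ⊆ bridgeSupport γ s ε := by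
  refine closure_minimal (fun x hx => ?_) (isCompact_bridgeSupport hγ hs hε.1).isClosed
  by_contra hxs
  refine hx (intervalIntegral.integral_zero_ae (.of_forall fun u hu => ?_))
  replace hu : u ∈ Icc ε (1 - ε) := uIcc_one_sub hε.2.le ▸ uIoc_subset_uIcc hu
  have hu' := Icc_subset_Ioo_of_mem hε.1 hu
  have hpath : nbrPath γ ((u * (1 - u))⁻¹ • (x - γ u)) u = x := by
    rw [nbrPath, smul_inv_smul₀ (mul_pos hu'.1 (sub_pos.2 hu'.2)).ne', add_sub_cancel]
  have hs0 : s ((u * (1 - u))⁻¹ • (x - γ u)) = 0 :=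
    image_eq_zero_of_notMem_tsupport fun h => hxs ⟨(u, _), ⟨hu, h⟩, hpath⟩
  simp only [bridgeDensity, hs0, mul_zero, zero_smul]

open Classical in
/-- The function `b_ε` as a test function, for `0 < ε < 1/2`; other values of `ε` give `0`. -/
def bridgeTest (s : ScalarTest) (ε : ℝ) : VectorTest :=
  if hε : ε ∈ Ioo (0 : ℝ) (1 / 2) then
    { toFun := bridgeFun γ s ε
      contDiff' := contDiff_bridgeFun hγ s.contDiff hε
      hasCompactSupport' :=
        (isCompact_bridgeSupport hγ s.hasCompactSupport hε.1).of_isClosed_subset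
          (isClosed_tsupport _) (tsupport_bridgeFun_subset hγ s.hasCompactSupport hε)
      tsupport_subset' := fun _ _ => trivial }
  else 0

theorem coe_bridgeTest (s : ScalarTest) {ε : ℝ} (hε : ε ∈ Ioo (0 : ℝ) (1 / 2)) :
    ⇑(bridgeTest hγ s ε) = bridgeFun γ s ε := by
  rw [bridgeTest, dif_pos hε]
  rfl

theorem tsupport_bridgeTest_subset_compl {s : ScalarTest} {X : Set R3}
    (hs : ∀ u ∈ Ioo (0 : ℝ) 1, ∀ y ∈ tsupport s, nbrPath γ y u ∉ X) {ε : ℝ}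
    (hε : ε ∈ Ioo (0 : ℝ) (1 / 2)) : tsupport (bridgeTest hγ s ε) ⊆ Xᶜ := by
  rw [coe_bridgeTest hγ s hε]
  refine (tsupport_bridgeFun_subset hγ s.hasCompactSupport hε).trans ?_
  rintro _ ⟨⟨u, y⟩, ⟨hu, hy⟩, rfl⟩
  exact hs u (Icc_subset_Ioo_of_mem hε.1 hu) y hy

theorem pairing_bridgeTest (s : ScalarTest) (g : VectorTest) {ε : ℝ}
    (hε : ε ∈ Ioo (0 : ℝ) (1 / 2)) :
    pairing (bridgeTest hγ s ε) g = ∫ u in ε..(1 - ε), flux γ s g u := by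
  rw [pairing, coe_bridgeTest hγ s hε]
  exact integral_inner_bridgeFun hγ s.contDiff g hε

theorem tendsto_pairing_bridgeTest (s : ScalarTest) (g : VectorTest) :
    Tendsto (fun ε => pairing (bridgeTest hγ s ε) g) (𝓝[>] 0) (𝓝 (bridgeFunctional hγ s g)) := by
  refine (tendsto_integral_flux hγ s g).congr' ?_
  filter_upwards [Ioo_mem_nhdsGT one_half_pos] with ε hε
  exact (pairing_bridgeTest hγ s g hε).symm

/-! ### Localization near the end points -/

include hγ in
theorem eventually_forall_nbrPath_mem {a : ℝ} (ha : a ∈ Icc (0 : ℝ) 1) (ha0 : a * (1 - a) = 0)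
    {K : Set R3} (hK : IsCompact K) {V : Set R3} (hV : V ∈ 𝓝 (γ a)) :
    ∀ᶠ u in 𝓝[Icc 0 1] a, ∀ y ∈ K, nbrPath γ y u ∈ V := by
  have h : ∀ᶠ p in 𝓝[Icc 0 1] a ×ˢ 𝓝ˢ K, nbrPath γ p.2 p.1 ∈ V := by
    refine hK.mem_prod_nhdsSet_of_forall fun y _ => ?_
    have hc := (continuousOn_nbrPath hγ (a, y) ⟨ha, trivial⟩).tendsto
    rw [nhdsWithin_prod_eq, nhdsWithin_univ] at hc
    refine hc.eventually_mem ?_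
    rwa [nbrPath, ha0, zero_smul, add_zero]
  exact h.curry.mono fun _ hu => hu.self_of_nhdsSet

theorem exists_bridgeFunctional_eq_pairing (s : ScalarTest) {V : Set R3} (hV0 : V ∈ 𝓝 (γ 0))
    (hV1 : V ∈ 𝓝 (γ 1)) :
    ∃ ε ∈ Ioo (0 : ℝ) (1 / 2), ∀ g : VectorTest, EqOn g 0 V →
      bridgeFunctional hγ s g = pairing (bridgeTest hγ s ε) g := by
  have e0 := eventually_forall_nbrPath_mem hγ (a := 0) (by simp) (by simp) s.hasCompactSupport hV0
  have e1 := eventually_forall_nbrPath_mem hγ (a := 1) (by simp) (by simp) s.hasCompactSupport hV1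
  rw [nhdsWithin_Icc_eq_nhdsGE zero_lt_one] at e0
  rw [nhdsWithin_Icc_eq_nhdsLE zero_lt_one] at e1
  obtain ⟨δ₀, hδ₀, h0⟩ := mem_nhdsGE_iff_exists_Icc_subset.1 e0
  obtain ⟨δ₁, hδ₁, h1⟩ := mem_nhdsLE_iff_exists_Icc_subset.1 e1
  obtain ⟨ε, hε, hlt⟩ := exists_between (lt_min (lt_min hδ₀ (sub_pos.2 hδ₁)) one_half_pos)
  obtain ⟨⟨hε₀, hε₁⟩, hε'⟩ : (ε < δ₀ ∧ ε < 1 - δ₁) ∧ ε < 1 / 2 := by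
    simpa only [lt_min_iff] using hlt
  refine ⟨ε, ⟨hε, hε'⟩, fun g hg => ?_⟩
  have hi {a b : ℝ} (ha : a ∈ Icc (0 : ℝ) 1) (hb : b ∈ Icc (0 : ℝ) 1) :=
    intervalIntegrable_flux hγ s g.continuous ha hb
  have hstart : ∫ u in (0 : ℝ)..ε, flux γ s g u = 0 := by
    refine intervalIntegral.integral_zero_ae (.of_forall fun u hu => ?_)
    rw [uIoc_of_le hε.le] at hu
    exact flux_eq_zero fun y hy => hg (h0 ⟨hu.1.le, hu.2.trans hε₀.le⟩ y hy)
  have hend : ∫ u in (1 - ε)..1, flux γ s g u = 0 := by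
    refine intervalIntegral.integral_zero_ae (.of_forall fun u hu => ?_)
    rw [uIoc_of_le (by linarith)] at hu
    exact flux_eq_zero fun y hy => hg (h1 ⟨by linarith [hu.1], hu.2⟩ y hy)
  have hmem : ε ∈ Icc (0 : ℝ) 1 := ⟨hε.le, by linarith⟩
  have hmem' : 1 - ε ∈ Icc (0 : ℝ) 1 := ⟨by linarith, by linarith⟩
  rw [pairing_bridgeTest hγ s g ⟨hε, hε'⟩, bridgeFunctional_apply,
    ← intervalIntegral.integral_add_adjacent_intervals (hi (by simp) hmem) (hi hmem (by simp)),
    ← intervalIntegral.integral_add_adjacent_intervals (hi hmem hmem') (hi hmem' (by simp)),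
    hstart, hend, zero_add, add_zero]

end Bridge

theorem nbrPath_ne_of_norm_lt {γ : ℝ → R3} {R : ℝ} {x y : R3} {u : ℝ} (hu : u ∈ Ioo (0 : ℝ) 1)
    (hR : R ≤ u⁻¹ * (1 - u)⁻¹ * ‖γ u - x‖) (hy : ‖y‖ < R) : nbrPath γ y u ≠ x := by
  rintro rfl
  have hu0 : 0 < u * (1 - u) := mul_pos hu.1 (sub_pos.2 hu.2)
  rw [nbrPath, sub_add_cancel_left, norm_neg, norm_smul, Real.norm_of_nonneg hu0.le, ← mul_inv,
    inv_mul_cancel_left₀ hu0.ne'] at hR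
  exact hR.not_gt hy

/-! ### Divergence and integration by parts -/

theorem continuous_partialDeriv {B : R3 → R3} (hB : ContDiff ℝ 1 B) (j i : Fin 3) :
    Continuous (partialDeriv B j i) :=
  (EuclideanSpace.proj i : R3 →L[ℝ] ℝ).continuous.comp
    ((hB.continuous_fderiv one_ne_zero).clm_apply continuous_const)

theorem continuous_divFun {B : R3 → R3} (hB : ContDiff ℝ 1 B) : Continuous (divFun B) :=
  continuous_finsetSum _ fun i _ => continuous_partialDeriv hB i i

theorem fderiv_coord_apply {B : R3 → R3} {x : R3} (hB : DifferentiableAt ℝ B x) (i : Fin 3)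
    (v : R3) : fderiv ℝ (fun x => B x i) x v = fderiv ℝ B x v i := by
  have h := ((EuclideanSpace.proj i : R3 →L[ℝ] ℝ).hasFDerivAt (x := B x)).comp x hB.hasFDerivAt
  exact congrArg (fun L : R3 →L[ℝ] ℝ => L v) h.fderiv

theorem inner_grad (φ : ScalarTest) (x a : R3) : inner ℝ a (grad φ x) = fderiv ℝ φ x a := by
  rw [real_inner_comm]
  exact InnerProductSpace.toDual_symm_apply

theorem grad_apply_coord (φ : ScalarTest) (x : R3) (i : Fin 3) :
    grad φ x i = fderiv ℝ φ x (EuclideanSpace.single i 1) := by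
  rw [← inner_grad, EuclideanSpace.inner_single_left, map_one, one_mul]

theorem integrable_scalarTest_mul (φ : ScalarTest) {f : R3 → ℝ} (hf : Continuous f) :
    Integrable fun x => φ x * f x :=
  (φ.continuous.mul hf).integrable_of_hasCompactSupport φ.hasCompactSupport.mul_right

theorem integrable_fderiv_scalarTest_mul (φ : ScalarTest) (v : R3) {f : R3 → ℝ}
    (hf : Continuous f) : Integrable fun x => fderiv ℝ φ x v * f x :=
  (((φ.contDiff.continuous_fderiv (by simp)).clm_apply continuous_const).mul
    hf).integrable_of_hasCompactSupport (φ.hasCompactSupport.fderiv_apply ℝ v).mul_right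

theorem integral_mul_partialDeriv (φ : ScalarTest) {B : R3 → R3} (hB : ContDiff ℝ 1 B)
    (j i : Fin 3) : ∫ x, φ x * partialDeriv B j i x =
      -∫ x, fderiv ℝ φ x (EuclideanSpace.single j 1) * B x i := by
  have hBi : ContDiff ℝ 1 fun x => B x i := (contDiff_piLp 2).1 hB i
  have hpartial : partialDeriv B j i = fun x =>
      fderiv ℝ (fun x => B x i) x (EuclideanSpace.single j 1) :=
    funext fun x => (fderiv_coord_apply (hB.differentiable one_ne_zero x) i _).symm
  have hint := integrable_scalarTest_mul φ (continuous_partialDeriv hB j i)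
  rw [hpartial] at hint ⊢
  exact integral_mul_fderiv_eq_neg_fderiv_mul_of_integrable
    (integrable_fderiv_scalarTest_mul φ _ hBi.continuous) hint
    (integrable_scalarTest_mul φ hBi.continuous)
    (fun x _ => φ.contDiff.differentiable (by simp) x)
    (fun x _ => hBi.differentiable one_ne_zero x)

theorem integral_mul_divFun (φ : ScalarTest) {B : R3 → R3} (hB : ContDiff ℝ 1 B) :
    ∫ x, φ x * divFun B x = -∫ x, inner ℝ (B x) (grad φ x) := by
  have hinner (x : R3) : inner ℝ (B x) (grad φ x) =
      ∑ i, fderiv ℝ φ x (EuclideanSpace.single i 1) * B x i := by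
    rw [inner_grad, clm_apply_eq_sum]
    simp only [smul_eq_mul, mul_comm]
  have hBi (i : Fin 3) : Continuous fun x => B x i := ((contDiff_piLp 2).1 hB i).continuous
  simp only [divFun, Finset.mul_sum, hinner]
  rw [integral_finsetSum _ fun i _ => integrable_scalarTest_mul φ (continuous_partialDeriv hB i i),
    integral_finsetSum _ fun i _ => integrable_fderiv_scalarTest_mul φ _ (hBi i)]
  simp only [integral_mul_partialDeriv φ hB, Finset.sum_neg_distrib]

theorem divFun_eq_zero_of_forall_integral_inner_grad {B : R3 → R3} (hB : ContDiff ℝ 1 B)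
    {U : Set R3} (hU : IsOpen U)
    (h : ∀ φ : ScalarTest, tsupport φ ⊆ U → ∫ x, inner ℝ (B x) (grad φ x) = 0) :
    EqOn (divFun B) 0 U := by
  have hdiv := continuous_divFun hB
  have hae : ∀ᵐ x, x ∈ U → divFun B x = 0 := by
    refine hU.ae_eq_zero_of_integral_contDiff_smul_eq_zero
      (hdiv.locallyIntegrable.locallyIntegrableOn U) fun φ hφ hφc hφU => ?_
    let φ' : ScalarTest := ⟨φ, hφ, hφc, fun _ _ => trivial⟩
    exact (integral_mul_divFun φ' hB).trans (neg_eq_zero.2 (h φ' hφU))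
  exact Measure.eqOn_open_of_ae_eq ((ae_restrict_iff' hU.measurableSet).2 hae) hU
    hdiv.continuousOn continuousOn_const

/-! ### Gauss' theorem for parametrized cubes -/

section Gauss

/-- The derivative of `u ↦ i.insertNth a u`, which inserts `0` at the place `i`. -/
def insertZero (i : Fin 3) : (Fin 2 → ℝ) →L[ℝ] (Fin 3 → ℝ) :=
  ContinuousLinearMap.pi
    (i.insertNth (α := fun _ => (Fin 2 → ℝ) →L[ℝ] ℝ) 0 fun j => ContinuousLinearMap.proj j)

theorem insertZero_single (i : Fin 3) (j : Fin 2) :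
    insertZero i (Pi.single j 1) = Pi.single (i.succAbove j) 1 := by
  ext k
  induction k using Fin.succAboveCases i with
  | x => simp [insertZero, (Fin.succAbove_ne i j).symm]
  | p k => simp [insertZero, Pi.single_apply]

theorem hasFDerivAt_insertNth (i : Fin 3) (a : ℝ) (u : Fin 2 → ℝ) :
    HasFDerivAt (fun u : Fin 2 → ℝ => (i.insertNth a u : Fin 3 → ℝ)) (insertZero i) u := by
  refine hasFDerivAt_pi.2 fun k => ?_
  induction k using Fin.succAboveCases i with
  | x => simpa using hasFDerivAt_const a u
  | p k => simpa only [Fin.insertNth_apply_succAbove] using hasFDerivAt_apply k u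

variable {c : (Fin 3 → ℝ) → R3}

theorem inner_normal_face (hc : Differentiable ℝ c) (B : R3 → R3) (i : Fin 3) (a : ℝ)
    (u : Fin 2 → ℝ) : inner ℝ (B (face c i a u)) (normal (face c i a) u) =
      pullback B c (Pi.single (i.succAbove 0) 1) (Pi.single (i.succAbove 1) 1)
        (i.insertNth a u) := by
  have h : HasFDerivAt (face c i a) ((fderiv ℝ c (i.insertNth a u)).comp (insertZero i)) u :=
    (hc _).hasFDerivAt.comp u (hasFDerivAt_insertNth i a u)
  rw [normal, h.fderiv, ContinuousLinearMap.comp_apply, ContinuousLinearMap.comp_apply,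
    insertZero_single, insertZero_single]
  rfl

theorem pullback_swap {E : Type*} [NormedAddCommGroup E] [NormedSpace ℝ E] (B : R3 → R3)
    (G : E → R3) (v w : E) : pullback B G v w = -pullback B G w v := by
  ext x
  simp only [pullback, Pi.neg_apply, inner_cross]
  ring

theorem det_jacobian (c : (Fin 3 → ℝ) → R3) (u : Fin 3 → ℝ) : (jacobian c u).det =
    inner ℝ (fderiv ℝ c u (Pi.single 0 1))
      (cross (fderiv ℝ c u (Pi.single 1 1)) (fderiv ℝ c u (Pi.single 2 1))) := by
  rw [inner_cross, Matrix.det_fin_three]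
  simp only [jacobian, Matrix.of_apply]
  ring

/-- The component in direction `i` of the flux `2`-form of `B` in the coordinates `c`, signed as in
the boundary of the cube. -/
def faceFlux (B : R3 → R3) (c : (Fin 3 → ℝ) → R3) (i : Fin 3) : (Fin 3 → ℝ) → ℝ :=
  (-1 : ℝ) ^ (i : ℕ) • pullback B c (Pi.single (i.succAbove 0) 1) (Pi.single (i.succAbove 1) 1)

variable {B : R3 → R3}

theorem contDiff_faceFlux (hc : ContDiff ℝ 2 c) (hB : ContDiff ℝ 1 B) (i : Fin 3) :
    ContDiff ℝ 1 (faceFlux B c i) :=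
  contDiff_const.smul (contDiff_pullback hB (hc.of_le (by norm_num)) _ _)

theorem sum_fderiv_faceFlux (hc : ContDiff ℝ 2 c) (hB : ContDiff ℝ 1 B) (u : Fin 3 → ℝ) :
    ∑ i, fderiv ℝ (faceFlux B c i) u (Pi.single i 1) = divFun B (c u) * (jacobian c u).det := by
  have h0 : faceFlux B c 0 = pullback B c (Pi.single 1 1) (Pi.single 2 1) := by
    simp [faceFlux]
  have h1 : faceFlux B c 1 = pullback B c (Pi.single 2 1) (Pi.single 0 1) := by
    rw [pullback_swap]
    simp [faceFlux]
  have h2 : faceFlux B c 2 = pullback B c (Pi.single 0 1) (Pi.single 1 1) := by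
    rw [faceFlux, show ((-1 : ℝ) ^ ((2 : Fin 3) : ℕ)) = 1 by norm_num, one_smul]
    rfl
  rw [Fin.sum_univ_three, h0, h1, h2,
    fderiv_pullback_cyclic (hB.differentiable one_ne_zero _) hc.contDiffAt, det_jacobian]

theorem sum_integral_faces_eq (hc : ContDiff ℝ 2 c) (hB : ContDiff ℝ 1 B) :
    ∑ i : Fin 3, (-1 : ℝ) ^ (i : ℕ) *
      ((∫ u in Icc (0 : Fin 2 → ℝ) 1, inner ℝ (B (face c i 1 u)) (normal (face c i 1) u)) -
        ∫ u in Icc (0 : Fin 2 → ℝ) 1, inner ℝ (B (face c i 0 u)) (normal (face c i 0) u)) =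
    ∫ u in Icc (0 : Fin 3 → ℝ) 1, divFun B (c u) * (jacobian c u).det := by
  have hflux (i : Fin 3) := contDiff_faceFlux hc hB i
  have hdiv : Continuous fun u => ∑ i, fderiv ℝ (faceFlux B c i) u (Pi.single i 1) :=
    continuous_finsetSum _ fun i _ =>
      ((hflux i).continuous_fderiv one_ne_zero).clm_apply continuous_const
  have key := integral_divergence_of_hasFDerivAt_off_countable' (0 : Fin 3 → ℝ) 1
    zero_le_one (faceFlux B c) (fun i u => fderiv ℝ (faceFlux B c i) u) ∅ countable_empty
    (fun i => (hflux i).continuous.continuousOn)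
    (fun u _ i => ((hflux i).differentiable one_ne_zero u).hasFDerivAt)
    (hdiv.continuousOn.integrableOn_compact isCompact_Icc)
  simp only [sum_fderiv_faceFlux hc hB] at key
  rw [key]
  refine Finset.sum_congr rfl fun i _ => ?_
  simp only [inner_normal_face (hc.differentiable two_ne_zero), mul_sub, faceFlux, Pi.smul_apply,
    smul_eq_mul, integral_const_mul, Pi.one_apply, Pi.zero_apply]
  rfl

end Gauss

/-! ### Integration over a region -/

section Integration

variable {c : (Fin 3 → ℝ) → R3}

theorem hasFDerivAt_ofLp_comp (hc : Differentiable ℝ c) (u : Fin 3 → ℝ) :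
    HasFDerivAt (fun u => (c u).ofLp)
      ((PiLp.continuousLinearEquiv 2 ℝ (fun _ : Fin 3 => ℝ) : R3 →L[ℝ] (Fin 3 → ℝ)).comp
        (fderiv ℝ c u)) u :=
  (PiLp.continuousLinearEquiv 2 ℝ (fun _ : Fin 3 => ℝ)).hasFDerivAt.comp u (hc u).hasFDerivAt

theorem det_ofLp_comp_fderiv (c : (Fin 3 → ℝ) → R3) (u : Fin 3 → ℝ) :
    ((PiLp.continuousLinearEquiv 2 ℝ (fun _ : Fin 3 => ℝ) : R3 →L[ℝ] (Fin 3 → ℝ)).comp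
      (fderiv ℝ c u)).det = (jacobian c u).det := by
  rw [ContinuousLinearMap.det, ← LinearMap.det_toMatrix']
  congr 1

theorem toLp_preimage_image (c : (Fin 3 → ℝ) → R3) (S : Set (Fin 3 → ℝ)) :
    WithLp.toLp 2 ⁻¹' (c '' S) = (fun u => (c u).ofLp) '' S := by
  change (WithLp.equiv 2 (Fin 3 → ℝ)).symm ⁻¹' (c '' S) = _
  rw [← Equiv.image_eq_preimage_symm, image_image]
  rfl

theorem setIntegral_mul_det_jacobian (hc : Differentiable ℝ c) {S : Set (Fin 3 → ℝ)}
    (hS : MeasurableSet S) (hinj : InjOn c S) (hdet : ∀ u ∈ S, 0 ≤ (jacobian c u).det)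
    (ψ : R3 → ℝ) : ∫ u in S, ψ (c u) * (jacobian c u).det = ∫ z in c '' S, ψ z := by
  rw [← (PiLp.volume_preserving_toLp (Fin 3)).setIntegral_preimage_emb
      (MeasurableEquiv.toLp 2 (Fin 3 → ℝ)).measurableEmbedding,
    toLp_preimage_image,
    integral_image_eq_integral_abs_det_fderiv_smul volume hS
      (fun u _ => (hasFDerivAt_ofLp_comp hc u).hasFDerivWithinAt)
      (fun u hu v hv h => hinj hu hv (WithLp.ofLp_injective 2 h))]
  refine setIntegral_congr_fun hS fun u hu => ?_
  simp only [det_ofLp_comp_fderiv, abs_of_nonneg (hdet u hu), smul_eq_mul]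
  exact mul_comm _ _

theorem volume_image_eq_zero (hc : Differentiable ℝ c) {S : Set (Fin 3 → ℝ)}
    (hS : volume S = 0) : volume (c '' S) = 0 := by
  rw [← (PiLp.volume_preserving_toLp (Fin 3)).measure_preimage_emb
      (MeasurableEquiv.toLp 2 (Fin 3 → ℝ)).measurableEmbedding, toLp_preimage_image]
  exact addHaar_image_eq_zero_of_differentiableOn_of_addHaar_eq_zero volume
    (fun u _ => (hasFDerivAt_ofLp_comp hc u).differentiableAt.differentiableWithinAt) hS

/-- The open unit cube, on which the parametrizations of a region are injective. -/
abbrev openCube : Set (Fin 3 → ℝ) := univ.pi fun _ => Ioo (0 : ℝ) 1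

theorem measurableSet_openCube : MeasurableSet openCube :=
  MeasurableSet.univ_pi fun _ => measurableSet_Ioo

theorem openCube_subset_Icc : openCube ⊆ Icc (0 : Fin 3 → ℝ) 1 := fun _ hu =>
  ⟨fun i => (hu i trivial).1.le, fun i => (hu i trivial).2.le⟩

theorem openCube_ae_eq_Icc : openCube =ᵐ[volume] Icc (0 : Fin 3 → ℝ) 1 :=
  Measure.univ_pi_Ioo_ae_eq_Icc (f := (0 : Fin 3 → ℝ)) (g := 1)

namespace Region

variable (τ : Region)

theorem differentiable_cell (k : Fin τ.n) : Differentiable ℝ (τ.cell k) :=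
  (τ.smooth k).differentiable (by simp)

theorem isCompact_carrier : IsCompact τ.carrier :=
  isCompact_iUnion fun k => isCompact_Icc.image (τ.smooth k).continuous

theorem carrier_ae_eq : (⋃ k, τ.cell k '' openCube : Set R3) =ᵐ[volume] τ.carrier := by
  refine (LE.le.eventuallyLE
    (iUnion_mono fun k => image_mono openCube_subset_Icc)).antisymm (ae_le_set.2 ?_)
  refine measure_mono_null (t := ⋃ k, τ.cell k '' (Icc 0 1 \ openCube)) ?_
    (measure_iUnion_null fun k => volume_image_eq_zero (τ.differentiable_cell k)
      (ae_le_set.1 openCube_ae_eq_Icc.symm.le))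
  rintro z ⟨hz, hz'⟩
  obtain ⟨k, u, hu, rfl⟩ := mem_iUnion.1 hz
  exact mem_iUnion.2 ⟨k, u, ⟨hu, fun h => hz' (mem_iUnion.2 ⟨k, u, h, rfl⟩)⟩, rfl⟩

theorem setIntegral_carrier {ψ : R3 → ℝ} (hψ : Continuous ψ) :
    ∑ k, ∫ u in Icc (0 : Fin 3 → ℝ) 1, ψ (τ.cell k u) * (jacobian (τ.cell k) u).det =
      ∫ z in τ.carrier, ψ z := by
  rw [← setIntegral_congr_set τ.carrier_ae_eq, integral_iUnion_fintype
    (fun k => measurableSet_openCube.image_of_continuousOn_injOn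
      (τ.smooth k).continuous.continuousOn (τ.injOn k)) τ.disjoint fun k => ?_]
  · refine Finset.sum_congr rfl fun k _ => ?_
    rw [← setIntegral_congr_set openCube_ae_eq_Icc]
    exact setIntegral_mul_det_jacobian (τ.differentiable_cell k) measurableSet_openCube
      (τ.injOn k) (τ.orientation k) ψ
  · exact (hψ.continuousOn.integrableOn_compact τ.isCompact_carrier).mono_set
      ((image_mono openCube_subset_Icc).trans (subset_iUnion (fun k => τ.cell k '' Icc 0 1) k))

end Region

end Integration

/-! ### The functions `g_σ` of closed surfaces -/

section Surface

variable (τ : Region) (s : ScalarTest)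

theorem locallyIntegrable_indicator_carrier :
    LocallyIntegrable (τ.carrier.indicator fun _ => (1 : ℝ)) (volume : Measure R3) :=
  (locallyIntegrable_const 1).indicator τ.isCompact_carrier.measurableSet

theorem convolution_indicator_carrier (ψ : R3 → ℝ) (x : R3) :
    convolution (τ.carrier.indicator fun _ => (1 : ℝ)) ψ (ContinuousLinearMap.lsmul ℝ ℝ) volume x =
      ∫ z in τ.carrier, ψ (x - z) := by
  rw [convolution, ← integral_indicator τ.isCompact_carrier.measurableSet]
  refine integral_congr_ae (.of_forall fun z => ?_)
  by_cases hz : z ∈ τ.carrier <;> simp [hz]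

/-- The indicator function of a region, smeared with a test function. -/
def smearedIndicator : ScalarTest where
  toFun := convolution (τ.carrier.indicator fun _ => (1 : ℝ)) s (ContinuousLinearMap.lsmul ℝ ℝ)
    volume
  contDiff' := s.hasCompactSupport.contDiff_convolution_right _
    (locallyIntegrable_indicator_carrier τ) s.contDiff
  hasCompactSupport' := HasCompactSupport.convolution _
    (.intro τ.isCompact_carrier fun z hz => by simp [hz]) s.hasCompactSupport
  tsupport_subset' := fun _ _ => trivial

theorem smearedIndicator_apply (x : R3) :
    smearedIndicator τ s x = ∫ z in τ.carrier, s (x - z) :=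
  convolution_indicator_carrier τ s x

theorem grad_smearedIndicator_apply (x : R3) (i : Fin 3) :
    grad (smearedIndicator τ s) x i =
      ∫ z in τ.carrier, fderiv ℝ s (x - z) (EuclideanSpace.single i 1) := by
  rw [grad_apply_coord,
    ← convolution_indicator_carrier τ (fun z => fderiv ℝ s z (EuclideanSpace.single i 1))]
  have h := s.hasCompactSupport.hasFDerivAt_convolution_right (ContinuousLinearMap.lsmul ℝ ℝ)
    (locallyIntegrable_indicator_carrier τ) (s.contDiff.of_le (by simp)) x
  refine (congrArg (fun L : R3 →L[ℝ] ℝ => L (EuclideanSpace.single i 1)) h.fderiv).trans ?_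
  exact convolution_precompR_apply _ (locallyIntegrable_indicator_carrier τ)
    (s.hasCompactSupport.fderiv ℝ) (s.contDiff.continuous_fderiv (by simp)) x _

theorem divFun_smul_const {φ : R3 → ℝ} {z : R3} (hφ : DifferentiableAt ℝ φ z) (e : R3) :
    divFun (fun z => φ z • e) z = fderiv ℝ φ z e := by
  simp only [divFun, partialDeriv, (hφ.hasFDerivAt.smul_const e).fderiv]
  rw [clm_apply_eq_sum (fderiv ℝ φ z) e]
  simp [mul_comm]

theorem fderiv_comp_const_sub {E F : Type*} [NormedAddCommGroup E] [NormedSpace ℝ E]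
    [NormedAddCommGroup F] [NormedSpace ℝ F] {f : E → F} {x z : E}
    (hf : DifferentiableAt ℝ f (x - z)) (v : E) :
    fderiv ℝ (fun z => f (x - z)) z v = -fderiv ℝ f (x - z) v := by
  have h := hf.hasFDerivAt.comp z ((hasFDerivAt_id z).const_sub x)
  refine (congrArg (fun L : E →L[ℝ] F => L v) h.fderiv).trans ?_
  simp

theorem contDiff_face {n : WithTop ℕ∞} {c : (Fin 3 → ℝ) → R3} (hc : ContDiff ℝ n c) (i : Fin 3)
    (a : ℝ) : ContDiff ℝ n (face c i a) := by
  refine hc.comp (contDiff_pi.2 fun k => ?_)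
  induction k using Fin.succAboveCases i with
  | x => simpa using contDiff_const
  | p k => simpa using contDiff_apply ℝ ℝ k

theorem continuous_normal {σ : (Fin 2 → ℝ) → R3} (hσ : ContDiff ℝ 1 σ) :
    Continuous (normal σ) := by
  have h := hσ.continuous_fderiv one_ne_zero
  exact (crossCLM.continuous.comp (h.clm_apply continuous_const)).clm_apply
    (h.clm_apply continuous_const)

theorem patchFun_apply_coord {σ : (Fin 2 → ℝ) → R3} (hσ : ContDiff ℝ 1 σ) {ψ : R3 → ℝ}
    (hψ : Continuous ψ) (x : R3) (i : Fin 3) :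
    patchFun ψ σ x i = ∫ u in Icc (0 : Fin 2 → ℝ) 1,
      inner ℝ (ψ (x - σ u) • EuclideanSpace.single i (1 : ℝ)) (normal σ u) := by
  have hc : Continuous fun u => ψ (x - σ u) • normal σ u :=
    (hψ.comp (continuous_const.sub hσ.continuous)).smul (continuous_normal hσ)
  have h := (EuclideanSpace.proj i : R3 →L[ℝ] ℝ).integral_comp_comm
    (hc.continuousOn.integrableOn_compact (μ := volume)
      (isCompact_Icc (a := (0 : Fin 2 → ℝ)) (b := 1)))
  refine h.symm.trans (integral_congr_ae (.of_forall fun u => ?_))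
  simp [real_inner_smul_left, EuclideanSpace.inner_single_left]

/-- The `i`-th component is Gauss' theorem for the vector field `z ↦ s(x - z) eᵢ`. -/
theorem surfaceFun_eq_neg_grad_smearedIndicator (x : R3) :
    τ.surfaceFun s x = -grad (smearedIndicator τ s) x := by
  ext i
  have hφ : ContDiff ℝ 1 fun z => s (x - z) :=
    (s.contDiff.of_le (by simp)).comp (contDiff_const.sub contDiff_id)
  have hB : ContDiff ℝ 1 fun z => s (x - z) • EuclideanSpace.single i (1 : ℝ) :=
    hφ.smul contDiff_const
  have hdiv (z : R3) : divFun (fun z => s (x - z) • EuclideanSpace.single i (1 : ℝ)) z =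
      -fderiv ℝ s (x - z) (EuclideanSpace.single i 1) := by
    rw [divFun_smul_const (hφ.differentiable one_ne_zero z),
      fderiv_comp_const_sub (s.contDiff.differentiable (by simp) _)]
  have hvol := τ.setIntegral_carrier (continuous_divFun hB)
  rw [← Finset.sum_congr rfl fun k _ =>
    sum_integral_faces_eq (contDiff_infty.1 (τ.smooth k) 2) hB] at hvol
  simp only [hdiv, integral_neg] at hvol
  rw [PiLp.neg_apply, grad_smearedIndicator_apply, ← hvol]
  simp only [Region.surfaceFun, WithLp.ofLp_sum, WithLp.ofLp_smul, WithLp.ofLp_sub,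
    Finset.sum_apply, Pi.smul_apply, Pi.sub_apply, smul_eq_mul,
    patchFun_apply_coord ((contDiff_face (τ.smooth _) _ _).of_le (by simp)) s.continuous]

theorem indicator_eventuallyEq_const_of_notMem_frontier {E M : Type*} [TopologicalSpace E] [Zero M]
    {S : Set E} {x : E} (m : M) (hx : x ∉ frontier S) :
    S.indicator (fun _ => m) =ᶠ[𝓝 x] fun _ => S.indicator (fun _ => m) x := by
  by_cases hxS : x ∈ S
  · filter_upwards [mem_interior_iff_mem_nhds.1 ((mem_interior_iff_notMem_frontier hxS).2 hx)]
      with y hy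
    rw [indicator_of_mem hy, indicator_of_mem hxS]
  · rw [← frontier_compl] at hx
    filter_upwards [mem_interior_iff_mem_nhds.1 ((mem_interior_iff_notMem_frontier hxS).2 hx)]
      with y hy
    rw [indicator_of_notMem hy, indicator_of_notMem hxS]

variable {τ s} {δ : ℝ} (hs : tsupport s ⊆ Metric.ball 0 δ)

include hs in
theorem scalarTest_sub_eq_zero {x z : R3} (hz : z ∉ Metric.ball x δ) : s (x - z) = 0 :=
  image_eq_zero_of_notMem_tsupport fun h => hz <| by
    rw [Metric.mem_ball, dist_comm, dist_eq_norm]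
    exact mem_ball_zero_iff.1 (hs h)

include hs in
theorem smearedIndicator_eq_one (h1 : ∫ x, s x = 1) {x : R3}
    (hx : Metric.ball x δ ⊆ τ.carrier) : smearedIndicator τ s x = 1 := by
  rw [smearedIndicator_apply, setIntegral_eq_integral_of_forall_compl_eq_zero fun z hz =>
    scalarTest_sub_eq_zero hs fun h => hz (hx h), integral_sub_left_eq_self (fun z => s z), h1]

include hs in
theorem smearedIndicator_eq_zero {x : R3} (hx : Metric.ball x δ ⊆ τ.carrierᶜ) :
    smearedIndicator τ s x = 0 := by
  rw [smearedIndicator_apply]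
  exact setIntegral_eq_zero_of_forall_eq_zero fun z hz =>
    scalarTest_sub_eq_zero hs fun h => hx h hz

include hs in
theorem smearedIndicator_eq_indicator (hδ : 0 < δ) (h1 : ∫ x, s x = 1) {x : R3}
    (hx : x ∉ Metric.cthickening δ τ.surface) :
    smearedIndicator τ s x = τ.carrier.indicator 1 x := by
  have hball : Metric.ball x δ ⊆ interior τ.carrier ∪ (closure τ.carrier)ᶜ := by
    intro z hz
    by_contra hz'
    rw [mem_union, not_or, notMem_compl_iff] at hz'
    exact hx (Metric.mem_cthickening_of_dist_le x z δ _ ⟨hz'.2, hz'.1⟩ (Metric.mem_ball'.1 hz).le)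
  have hxball := Metric.mem_ball_self (x := x) hδ
  rcases (convex_ball x δ).isPreconnected.subset_or_subset isOpen_interior
    isClosed_closure.isOpen_compl (disjoint_compl_right.mono_left interior_subset_closure)
    hball with hin | hout
  · replace hin := hin.trans interior_subset
    rw [smearedIndicator_eq_one hs h1 hin, indicator_of_mem (hin hxball), Pi.one_apply]
  · replace hout := hout.trans (compl_subset_compl.2 subset_closure)
    rw [smearedIndicator_eq_zero hs hout, indicator_of_notMem (hout hxball)]

include hs in
theorem tsupport_grad_smearedIndicator_subset (hδ : 0 < δ) (h1 : ∫ x, s x = 1) :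
    tsupport (grad (smearedIndicator τ s)) ⊆ Metric.cthickening δ τ.surface := by
  refine closure_minimal (fun x hx => not_imp_comm.1 (fun hxδ => ?_) hx)
    Metric.isClosed_cthickening
  have hnear : ∀ᶠ y in 𝓝 x, y ∉ Metric.cthickening δ τ.surface :=
    Metric.isClosed_cthickening.isOpen_compl.mem_nhds hxδ
  have hsmeared : smearedIndicator τ s =ᶠ[𝓝 x] τ.carrier.indicator 1 :=
    hnear.mono fun y hy => smearedIndicator_eq_indicator hs hδ h1 hy
  have hconst := hsmeared.trans (indicator_eventuallyEq_const_of_notMem_frontier 1 fun hxτ =>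
    hxδ (Metric.self_subset_cthickening _ hxτ))
  change gradient (smearedIndicator τ s) x = 0
  rw [gradient, hconst.fderiv_eq]
  simp

end Surface

/-! ### Vector potentials from homotopies -/

/-- The pullback of the flux `2`-form of `B` along a map of `ℝ³` to itself, as a vector field. -/
def pullbackField (B φ : R3 → R3) (x : R3) : R3 :=
  !₂[pullback B φ (.single 1 1) (.single 2 1) x, pullback B φ (.single 2 1) (.single 0 1) x,
    pullback B φ (.single 0 1) (.single 1 1) x]

theorem pullbackField_id (B : R3 → R3) (x : R3) : pullbackField B (fun x => x) x = B x := by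
  ext i
  fin_cases i <;> simp [pullbackField, pullback, inner_cross]

theorem pullbackField_const (B : R3 → R3) (p x : R3) : pullbackField B (fun _ => p) x = 0 := by
  ext i
  fin_cases i <;> simp [pullbackField, pullback, inner_cross]

/-- The vector potential with components `∫₀¹ B(G) · (∂ₜG × ∂ᵢG) dt` that Poincaré's homotopy
operator assigns to `B` and the homotopy `G`. -/
def homotopyPotential (B : R3 → R3) (G : ℝ × R3 → R3) (x : R3) : R3 :=
  WithLp.toLp 2 fun i => ∫ t in (0 : ℝ)..1, pullback B G (1, 0) (0, .single i 1) (t, x)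

section HomotopyPotential

variable {B : R3 → R3} {G : ℝ × R3 → R3}

theorem contDiff_homotopyPotential (hB : ContDiff ℝ ∞ B) (hG : ContDiff ℝ ∞ G) :
    ContDiff ℝ ∞ (homotopyPotential B G) :=
  (contDiff_piLp 2).2 fun _ => contDiff_intervalIntegral (contDiff_pullback hB hG _ _) 0 1

theorem partialDeriv_homotopyPotential (hB : ContDiff ℝ ∞ B) (hG : ContDiff ℝ ∞ G)
    (j i : Fin 3) (x : R3) :
    partialDeriv (homotopyPotential B G) j i x =
      ∫ t in (0 : ℝ)..1,
        fderiv ℝ (pullback B G (1, 0) (0, .single i 1)) (t, x) (0, .single j 1) := by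
  have hp := contDiff_pullback hB hG (1, 0) (0, .single i 1)
  have hd := hasFDerivAt_intervalIntegral_of_contDiff (hp.of_le (by simp)) 0 1 x
  have hc : Continuous fun t : ℝ => (fderiv ℝ (pullback B G (1, 0) (0, .single i 1)) (t, x)).comp
      (ContinuousLinearMap.inr ℝ ℝ R3) :=
    ((hp.continuous_fderiv (by simp)).comp (.prodMk_left x)).clm_comp continuous_const
  rw [partialDeriv, ← fderiv_coord_apply
    ((contDiff_homotopyPotential hB hG).differentiable (by simp) x) i]
  refine (congrArg (fun L : R3 →L[ℝ] ℝ => L (.single j 1)) hd.fderiv).trans ?_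
  exact ContinuousLinearMap.intervalIntegral_apply (hc.intervalIntegrable 0 1) _

theorem pullback_slice (hG : Differentiable ℝ G) (v w : R3) (t : ℝ) (x : R3) :
    pullback B G (0, v) (0, w) (t, x) = pullback B (fun x => G (t, x)) v w x := by
  have h : HasFDerivAt (fun x => G (t, x))
      ((fderiv ℝ G (t, x)).comp (ContinuousLinearMap.inr ℝ ℝ R3)) x :=
    (hG (t, x)).hasFDerivAt.comp x (hasFDerivAt_prodMk_right t x)
  rw [pullback, pullback, h.fderiv]
  rfl

theorem partialDeriv_homotopyPotential_sub (hB : ContDiff ℝ ∞ B) (hG : ContDiff ℝ ∞ G) {x : R3}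
    (hdiv : ∀ t ∈ Icc (0 : ℝ) 1, divFun B (G (t, x)) = 0) (j k : Fin 3) :
    partialDeriv (homotopyPotential B G) j k x - partialDeriv (homotopyPotential B G) k j x =
      pullback B (fun x => G (1, x)) (.single j 1) (.single k 1) x -
        pullback B (fun x => G (0, x)) (.single j 1) (.single k 1) x := by
  have hp (v w : ℝ × R3) : ContDiff ℝ ∞ (pullback B G v w) := contDiff_pullback hB hG v w
  have hc (v w u : ℝ × R3) : Continuous fun t : ℝ => fderiv ℝ (pullback B G v w) (t, x) u :=
    (((hp v w).continuous_fderiv (by simp)).comp (.prodMk_left x)).clm_apply continuous_const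
  have hG' := hG.differentiable (by simp)
  rw [partialDeriv_homotopyPotential hB hG, partialDeriv_homotopyPotential hB hG,
    ← intervalIntegral.integral_sub ((hc _ _ _).intervalIntegrable 0 1)
      ((hc _ _ _).intervalIntegrable 0 1), ← pullback_slice hG', ← pullback_slice hG']
  have hclosed : ∀ t ∈ uIcc (0 : ℝ) 1,
      fderiv ℝ (pullback B G (1, 0) (0, .single k 1)) (t, x) (0, .single j 1) -
        fderiv ℝ (pullback B G (1, 0) (0, .single j 1)) (t, x) (0, .single k 1) =
      fderiv ℝ (pullback B G (0, .single j 1) (0, .single k 1)) (t, x) (1, 0) := fun t ht => by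
    rw [uIcc_of_le zero_le_one] at ht
    have h := fderiv_pullback_cyclic (hB.differentiable (by simp) (G (t, x)))
      (contDiff_infty.1 hG 2).contDiffAt (1, 0) (0, .single j 1) (0, .single k 1)
    rw [hdiv t ht, zero_mul, pullback_swap B G (0, .single k 1) (1, 0), fderiv_neg] at h
    simp only [_root_.neg_apply] at h
    linarith
  rw [intervalIntegral.integral_congr hclosed]
  refine intervalIntegral.integral_eq_sub_of_hasDerivAt
    (f := fun t => pullback B G (0, .single j 1) (0, .single k 1) (t, x)) (fun t _ => ?_)
    ((hc _ _ _).intervalIntegrable 0 1)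
  exact ((hp _ _).differentiable (by simp) (t, x)).hasFDerivAt.comp_hasDerivAt
    t ((hasDerivAt_id t).prodMk (hasDerivAt_const t x))

theorem curlFun_homotopyPotential (hB : ContDiff ℝ ∞ B) (hG : ContDiff ℝ ∞ G) {x : R3}
    (hdiv : ∀ t ∈ Icc (0 : ℝ) 1, divFun B (G (t, x)) = 0) :
    curlFun (homotopyPotential B G) x =
      pullbackField B (fun x => G (1, x)) x - pullbackField B (fun x => G (0, x)) x := by
  ext i
  fin_cases i <;> simp [curlFun, pullbackField, partialDeriv_homotopyPotential_sub hB hG hdiv]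

end HomotopyPotential

theorem curlFun_congr {α α' : R3 → R3} {x : R3} (h : α =ᶠ[𝓝 x] α') :
    curlFun α x = curlFun α' x := by
  simp only [curlFun, partialDeriv, h.fderiv_eq]

theorem ContractibleIn.exists_continuous_homotopy {K U : Set R3} (hK : IsCompact K)
    (h : ContractibleIn K U) :
    ∃ (p : R3) (g : C(ℝ × R3, R3)) (L : Set R3), IsCompact L ∧ L ⊆ U ∧
      ∀ x ∈ K, g (0, x) = p ∧ g (1, x) = x ∧ ∀ t ∈ Icc (0 : ℝ) 1, g (t, x) ∈ L := by
  obtain ⟨hKU, p, ⟨H⟩⟩ := h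
  have : CompactSpace K := isCompact_iff_compactSpace.1 hK
  have : TietzeExtension R3 := .of_tvs ℝ
  let H' : C(unitInterval × K, R3) :=
    ⟨fun q => H.symm q, continuous_subtype_val.comp H.symm.continuous⟩
  obtain ⟨g, hg⟩ := H'.exists_extension' <|
    isClosed_Icc.isClosedEmbedding_subtypeVal.prodMap hK.isClosed.isClosedEmbedding_subtypeVal
  have hgH (t : unitInterval) (x : K) : g (t, x) = H.symm (t, x) := congrFun hg (t, x)
  refine ⟨p, g, range H', isCompact_range H'.continuous, range_subset_iff.2 fun q => (H.symm q).2,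
    fun x hx => ⟨?_, ?_, fun t ht => ⟨(⟨t, ht⟩, ⟨x, hx⟩), (hgH ⟨t, ht⟩ ⟨x, hx⟩).symm⟩⟩⟩
  · exact (hgH 0 ⟨x, hx⟩).trans (congrArg Subtype.val (H.symm.apply_zero _))
  · exact (hgH 1 ⟨x, hx⟩).trans (congrArg Subtype.val (H.symm.apply_one _))

theorem ContractibleIn.exists_contDiff_homotopy {K U : Set R3} (hK : IsCompact K) (hU : IsOpen U)
    (h : ContractibleIn K U) :
    ∃ (p : R3) (G : ℝ × R3 → R3), ContDiff ℝ ∞ G ∧ (∀ x, G (0, x) = p) ∧ (∀ x, G (1, x) = x) ∧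
      ∀ t ∈ Icc (0 : ℝ) 1, ∀ x ∈ K, G (t, x) ∈ U := by
  obtain ⟨p, g, L, hL, hLU, hg⟩ := h.exists_continuous_homotopy hK
  obtain ⟨η, hη, hηU⟩ := hL.exists_cthickening_subset_open hU hLU
  obtain ⟨F, hF, hFg, -⟩ := g.continuous.exists_contDiff_approx ⊤
    (continuous_const (y := η / 2)) fun _ => half_pos hη
  have hslice (a : ℝ) : ContDiff ℝ ∞ fun q : ℝ × R3 => F (a, q.2) :=
    hF.comp (contDiff_const.prodMk contDiff_snd)
  -- The approximation `F` of the homotopy misses its ends by `p - F (0, x)` and `x - F (1, x)`.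
  refine ⟨p, fun q => F q + (1 - q.1) • (p - F (0, q.2)) + q.1 • (q.2 - F (1, q.2)),
    (hF.add ((contDiff_const.sub contDiff_fst).smul (contDiff_const.sub (hslice 0)))).add
      (contDiff_fst.smul (contDiff_snd.sub (hslice 1))),
    fun x => by simp, fun x => by simp, fun t ht x hx => ?_⟩
  obtain ⟨hg0, hg1, hgL⟩ := hg x hx
  have h0 : ‖p - F (0, x)‖ ≤ η / 2 := by
    rw [← hg0, ← dist_eq_norm']
    exact (hFg (0, x)).le
  have h1 : ‖x - F (1, x)‖ ≤ η / 2 := by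
    nth_rw 1 [← hg1]
    rw [← dist_eq_norm']
    exact (hFg (1, x)).le
  have hcorr : ‖(1 - t) • (p - F (0, x)) + t • (x - F (1, x))‖ ≤ η / 2 :=
    mem_closedBall_zero_iff.1 <| convex_closedBall 0 (η / 2) (mem_closedBall_zero_iff.2 h0)
      (mem_closedBall_zero_iff.2 h1) (sub_nonneg.2 ht.2) ht.1 (sub_add_cancel 1 t)
  refine hηU (Metric.mem_cthickening_of_dist_le _ (g (t, x)) η _ (hgL t ht) ?_)
  calc dist (F (t, x) + (1 - t) • (p - F (0, x)) + t • (x - F (1, x))) (g (t, x))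
      ≤ ‖(1 - t) • (p - F (0, x)) + t • (x - F (1, x))‖ + dist (F (t, x)) (g (t, x)) := by
        rw [add_assoc]
        refine (dist_triangle _ (F (t, x)) _).trans_eq ?_
        rw [dist_self_add_left]
    _ ≤ η := by linarith [(hFg (t, x)).le]

theorem ContractibleIn.exists_curl_eqOn {K U : Set R3} (hK : IsCompact K) (hU : IsOpen U)
    (h : ContractibleIn K U) :
    ∃ L, IsCompact L ∧ K ⊆ L ∧ L ⊆ U ∧ ∀ B : R3 → R3, ContDiff ℝ ∞ B → EqOn (divFun B) 0 L →
      ∃ f : VectorTest, tsupport f ⊆ U ∧ EqOn (curl f) B K := by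
  obtain ⟨p, G, hG, hG0, hG1, hGU⟩ := h.exists_contDiff_homotopy hK hU
  refine ⟨G '' (Icc 0 1 ×ˢ K), (isCompact_Icc.prod hK).image hG.continuous,
    fun x hx => ⟨(1, x), ⟨right_mem_Icc.2 zero_le_one, hx⟩, hG1 x⟩,
    image_subset_iff.2 fun q hq => hGU q.1 hq.1 q.2 hq.2, fun B hB hdiv => ?_⟩
  have hcurl (x : R3) (hx : x ∈ K) : curlFun (homotopyPotential B G) x = B x := by
    rw [curlFun_homotopyPotential hB hG fun t ht => hdiv ⟨(t, x), ⟨ht, hx⟩, rfl⟩]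
    simp only [hG0, hG1, pullbackField_id, pullbackField_const, sub_zero]
  obtain ⟨W, hW, hKW, hWU, hWc⟩ := exists_open_between_and_isCompact_closure hK hU h.1
  obtain ⟨f, hf, hfW, hfα⟩ := exists_contDiff_eventuallyEq_nhdsSet hK.isClosed hW hKW
    (contDiff_homotopyPotential hB hG).contDiffOn
  refine ⟨⟨f, hf, hWc.of_isClosed_subset (isClosed_tsupport f) (hfW.trans subset_closure),
    fun _ _ => trivial⟩, (hfW.trans subset_closure).trans hWU, fun x hx => ?_⟩
  exact (curlFun_congr (hfα.filter_mono (nhds_le_nhdsSet hx))).trans (hcurl x hx)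

/-! ### The gauge bridge -/

theorem pairing_congr_left {f f' g : VectorTest} (h : EqOn f f' (tsupport g)) :
    pairing f g = pairing f' g := by
  refine integral_congr_ae (.of_forall fun x => ?_)
  by_cases hx : x ∈ tsupport g
  · simp only [h hx]
  · simp only [image_eq_zero_of_notMem_tsupport hx, inner_zero_right]

section GaugeBridge

variable {γ : ℝ → R3} (hγ : ContDiffOn ℝ ∞ γ (Icc 0 1)) (s : ScalarTest)

theorem exists_bridgeFunctional_eq_pairing_of_divFun_eq_zero {X L : Set R3} (hX : IsClosed X)
    (h0 : γ 0 ∈ X) (h1 : γ 1 ∈ X) (hL : IsClosed L) (hLX : L ⊆ Xᶜ) :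
    ∃ b : VectorTest, EqOn (divFun b) 0 L ∧
      ∀ g : VectorTest, tsupport g ⊆ L → bridgeFunctional hγ s g = pairing b g := by
  obtain ⟨W, hW, hLW, hWX⟩ := normal_exists_closure_subset hL hX.isOpen_compl hLX
  have hWX' {x : R3} (hx : x ∈ X) : (closure W)ᶜ ∈ 𝓝 x :=
    isClosed_closure.isOpen_compl.mem_nhds fun h => hWX h hx
  obtain ⟨ε, -, hbε⟩ := exists_bridgeFunctional_eq_pairing hγ s (hWX' h0) (hWX' h1)
  have hb (g : VectorTest) (hg : tsupport g ⊆ W) :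
      bridgeFunctional hγ s g = pairing (bridgeTest hγ s ε) g :=
    hbε g fun x hx => image_eq_zero_of_notMem_tsupport fun h => hx (subset_closure (hg h))
  refine ⟨bridgeTest hγ s ε, ?_, fun g hg => hb g (hg.trans hLW)⟩
  refine (divFun_eq_zero_of_forall_integral_inner_grad
    ((bridgeTest hγ s ε).contDiff.of_le (by simp)) hW fun φ hφ => ?_).mono hLW
  have hφX {x : R3} (hx : x ∈ X) : φ x = 0 :=
    image_eq_zero_of_notMem_tsupport fun h => hWX (subset_closure (hφ h)) hx
  refine (hb (grad φ) ((tsupport_gradient_subset φ).trans hφ)).symm.trans ?_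
  rw [bridgeFunctional_grad, hφX h0, hφX h1, sub_self, mul_zero]

theorem exists_bridgeFunctional_eq_pairing_curl {X O : Set R3} (hX : IsClosed X) (h0 : γ 0 ∈ X)
    (h1 : γ 1 ∈ X) (hO : IsCompact (closure O)) (hOX : ContractibleIn (closure O) Xᶜ) :
    ∃ f : VectorTest, tsupport f ⊆ Xᶜ ∧
      ∀ g : VectorTest, tsupport g ⊆ O → bridgeFunctional hγ s g = pairing (curl f) g := by
  obtain ⟨L, hL, hOL, hLX, hcurl⟩ := hOX.exists_curl_eqOn hO hX.isOpen_compl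
  obtain ⟨b, hdiv, hb⟩ :=
    exists_bridgeFunctional_eq_pairing_of_divFun_eq_zero hγ s hX h0 h1 hL.isClosed hLX
  obtain ⟨f, hfX, hf⟩ := hcurl b b.contDiff hdiv
  refine ⟨f, hfX, fun g hg => ?_⟩
  replace hg := hg.trans subset_closure
  rw [hb g (hg.trans hOL), pairing_congr_left (hf.mono hg)]

end GaugeBridge

section ClosedSurface

variable {X : Set R3}

theorem Region.isCompact_surface (τ : Region) : IsCompact τ.surface :=
  τ.isCompact_carrier.of_isClosed_subset isClosed_frontier
    τ.isCompact_carrier.isClosed.frontier_subset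

theorem Region.exists_smearedIndicator_eqOn_indicator (τ : Region) (hX : IsClosed X)
    (hτ : τ.surface ⊆ Xᶜ) :
    ∃ δ > 0, ∀ s : ScalarTest, tsupport s ⊆ Metric.ball 0 δ → ∫ x, s x = 1 →
      tsupport (-grad (smearedIndicator τ s) : VectorTest) ⊆ Xᶜ ∧
        EqOn (smearedIndicator τ s) (τ.carrier.indicator 1) X := by
  obtain ⟨δ, hδ, hδX⟩ := τ.isCompact_surface.exists_cthickening_subset_open hX.isOpen_compl hτ
  refine ⟨δ, hδ, fun s hs h1 => ⟨?_, fun x hx => ?_⟩⟩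
  · exact (tsupport_neg (grad (smearedIndicator τ s) : R3 → R3)).subset.trans
      ((tsupport_grad_smearedIndicator_subset hs hδ h1).trans hδX)
  · exact smearedIndicator_eq_indicator hs hδ h1 fun h => hδX h hx

end ClosedSurface

section BridgeAut

variable {X : Set R3} {γ : ℝ → R3} (hγ : ContDiffOn ℝ ∞ γ (Icc 0 1)) (s : ScalarTest)

/-- The gauge bridge on `𝔄(O)`. -/
def bridgeAut (O : Set R3) : observables O ≃⋆ₐ[ℂ] observables O :=
  functionalAut (bridgeFunctional hγ s) O

theorem coe_bridgeAut {O : Set R3} (a : observables O) :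
    (bridgeAut hγ s O a : Op) = Ad (expFunctional (bridgeFunctional hγ s)) a :=
  coe_functionalAut _ O a

theorem tendsto_Ad_expA_bridgeTest {O : Set R3} (a : observables O) :
    Tendsto (fun ε => Ad (expA (bridgeTest hγ s ε)) (a : Op)) (𝓝[>] 0)
      (𝓝 (bridgeAut hγ s O a : Op)) := by
  rw [coe_bridgeAut]
  exact tendsto_Ad_expA (tendsto_pairing_bridgeTest hγ s) a.2.1

theorem coe_bridgeAut_inclusion {O O' : Set R3} (h : O ⊆ O') (a : observables O) :
    (bridgeAut hγ s O' (StarSubalgebra.inclusion (observables_mono h) a) : Op) =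
      bridgeAut hγ s O a := by
  simp only [coe_bridgeAut, StarSubalgebra.inclusion_apply, Subtype.map_coe, id]

theorem bridgeAut_obsDivE (h0 : γ 0 ∈ X) (h1 : γ 1 ∈ X) (s' : ScalarTest)
    (hs' : tsupport s' ⊆ Xᶜ) : bridgeAut hγ s Xᶜ (obsDivE Xᶜ s' hs') = obsDivE Xᶜ s' hs' := by
  have hX {x : R3} (hx : x ∈ X) : s' x = 0 :=
    image_eq_zero_of_notMem_tsupport fun h => hs' h hx
  refine functionalAut_obsDivE hs' ?_
  rw [bridgeFunctional_grad, hX h0, hX h1, sub_self, mul_zero]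

theorem bridgeAut_obsE_neg_grad {O : Set R3} {φ : ScalarTest}
    (hφ : tsupport (-grad φ : VectorTest) ⊆ O) :
    bridgeAut hγ s O (obsE O (-grad φ) hφ) =
      Complex.exp (Complex.I * ((∫ y, s y) * (φ (γ 0) - φ (γ 1)) : ℝ)) •
        obsE O (-grad φ) hφ := by
  rw [bridgeAut, functionalAut_obsE, map_neg, bridgeFunctional_grad, ← mul_neg, neg_sub]

theorem exists_bridgeAut_obsE_surface (hX : IsClosed X) (h0 : γ 0 ∈ X) (h1 : γ 1 ∈ X)
    (τ : Region) (hτ : τ.surface ⊆ Xᶜ) :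
    ∃ δ > 0, ∀ s' : ScalarTest, tsupport s' ⊆ Metric.ball 0 δ → ∫ x, s' x = 1 →
      ∃ (g : VectorTest) (hg : tsupport g ⊆ Xᶜ), (∀ x, g x = τ.surfaceFun s' x) ∧
        bridgeAut hγ s Xᶜ (obsE Xᶜ g hg) =
          Complex.exp (Complex.I * ((∫ y, s y) *
            (τ.carrier.indicator 1 (γ 0) - τ.carrier.indicator 1 (γ 1)) : ℝ)) • obsE Xᶜ g hg := by
  obtain ⟨δ, hδ, h⟩ := τ.exists_smearedIndicator_eqOn_indicator hX hτ
  refine ⟨δ, hδ, fun s' hs' hs'1 => ?_⟩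
  obtain ⟨hsupp, hval⟩ := h s' hs' hs'1
  refine ⟨_, hsupp, fun x => (surfaceFun_eq_neg_grad_smearedIndicator τ s' x).symm, ?_⟩
  rw [bridgeAut_obsE_neg_grad, hval h0, hval h1]

theorem exists_bridgeAut_eq_Ad_expB (hX : IsClosed X) (h0 : γ 0 ∈ X) (h1 : γ 1 ∈ X) {O : Set R3}
    (hO : IsCompact (closure O)) (hOX : ContractibleIn (closure O) Xᶜ) :
    ∃ f : VectorTest, tsupport f ⊆ Xᶜ ∧ ∀ a : observables Xᶜ, (a : Op) ∈ observables O →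
      (bridgeAut hγ s Xᶜ a : Op) = Ad (expB f) a := by
  obtain ⟨f, hfX, hf⟩ := exists_bridgeFunctional_eq_pairing_curl hγ s hX h0 h1 hO hOX
  exact ⟨f, hfX, fun a ha => Ad_expFunctional_eq_Ad_expA hf ha.1⟩

theorem nbrPath_notMem_of_norm_lt {x₁ x₂ y : R3} {u R : ℝ} (hu : u ∈ Ioo (0 : ℝ) 1)
    (h₁ : R ≤ u⁻¹ * (1 - u)⁻¹ * ‖γ u - x₁‖) (h₂ : R ≤ u⁻¹ * (1 - u)⁻¹ * ‖γ u - x₂‖)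
    (hX : ∀ x ∈ X, x ≠ x₁ → x ≠ x₂ → nbrPath γ y u ≠ x) (hy : ‖y‖ < R) : nbrPath γ y u ∉ X :=
  fun h => hX _ h (nbrPath_ne_of_norm_lt hu h₁ hy) (nbrPath_ne_of_norm_lt hu h₂ hy) rfl

end BridgeAut

end

end GaugeBridge

theorem lemma3p2_general {X : Set R3} (hX : IsClosed X) {γ : ℝ → R3}
    (hγ : ContDiffOn ℝ ∞ γ (Icc 0 1)) (hγ0 : γ 0 ∈ X) (hγ1 : γ 1 ∈ X) {q : ℝ} (s : ScalarTest)
    (hs : ∀ u ∈ Ioo (0 : ℝ) 1, ∀ y ∈ tsupport s, nbrPath γ y u ∉ X) (hsq : ∫ x, s x = q) :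
    ∃ b : ℝ → VectorTest,
      (∀ ε ∈ Ioo (0 : ℝ) (1 / 2), (∀ x, b ε x = bridgeFun γ s ε x) ∧ tsupport (b ε) ⊆ Xᶜ) ∧
      ∃ (β : observables univ ≃⋆ₐ[ℂ] observables univ) (βX : observables Xᶜ ≃⋆ₐ[ℂ] observables Xᶜ),
        (∀ a : observables univ,
          Tendsto (fun ε => Ad (expA (b ε)) (a : Op)) (𝓝[>] 0) (𝓝 (β a : Op))) ∧
        (∀ a : observables Xᶜ,
          (β (StarSubalgebra.inclusion (observables_mono (subset_univ _)) a) : Op) = βX a) ∧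
        (∀ (s' : ScalarTest) (hs' : tsupport s' ⊆ Xᶜ),
          βX (obsDivE Xᶜ s' hs') = obsDivE Xᶜ s' hs') ∧
        (∀ τ : Region, τ.surface ⊆ Xᶜ → ∃ δ > 0, ∀ s' : ScalarTest,
          tsupport s' ⊆ Metric.ball 0 δ → ∫ x, s' x = 1 →
          ∃ (g : VectorTest) (hg : tsupport g ⊆ Xᶜ), (∀ x, g x = τ.surfaceFun s' x) ∧
            (γ 0 ∉ τ.carrier → γ 1 ∉ τ.carrier → βX (obsE Xᶜ g hg) = obsE Xᶜ g hg) ∧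
            (γ 0 ∈ τ.carrier → γ 1 ∉ τ.carrier →
              βX (obsE Xᶜ g hg) = Complex.exp (Complex.I * q) • obsE Xᶜ g hg) ∧
            (γ 0 ∉ τ.carrier → γ 1 ∈ τ.carrier →
              βX (obsE Xᶜ g hg) = Complex.exp (-(Complex.I * q)) • obsE Xᶜ g hg) ∧
            (γ 0 ∈ τ.carrier → γ 1 ∈ τ.carrier → βX (obsE Xᶜ g hg) = obsE Xᶜ g hg)) ∧
        (∀ O : Set R3, IsCompact (closure O) → ContractibleIn (closure O) Xᶜ →
          ∃ f : VectorTest, tsupport f ⊆ Xᶜ ∧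
            ∀ a : observables Xᶜ, (a : Op) ∈ observables O → (βX a : Op) = Ad (expB f) a) := by
  refine ⟨bridgeTest hγ s, fun ε hε => ⟨fun x => congrFun (coe_bridgeTest hγ s hε) x,
      tsupport_bridgeTest_subset_compl hγ hs hε⟩,
    bridgeAut hγ s univ, bridgeAut hγ s Xᶜ,
    tendsto_Ad_expA_bridgeTest hγ s, coe_bridgeAut_inclusion hγ s (subset_univ _),
    bridgeAut_obsDivE hγ s hγ0 hγ1, fun τ hτ => ?_,
    fun _ => exists_bridgeAut_eq_Ad_expB hγ s hX hγ0 hγ1⟩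
  obtain ⟨δ, hδ, h⟩ := exists_bridgeAut_obsE_surface hγ s hX hγ0 hγ1 τ hτ
  refine ⟨δ, hδ, fun s' hs' hs'1 => ?_⟩
  obtain ⟨g, hg, hgτ, hβ⟩ := h s' hs' hs'1
  rw [hsq] at hβ
  exact ⟨g, hg, hgτ, fun h₀ h₁ => by simpa [h₀, h₁] using hβ,
    fun h₀ h₁ => by simpa [h₀, h₁] using hβ, fun h₀ h₁ => by simpa [h₀, h₁] using hβ,
    fun h₀ h₁ => by simpa [h₀, h₁] using hβ⟩

theorem lemma3p2 (X : Finset R3) (x₁ x₂ : R3) (hx₁ : x₁ ∈ X) (hx₂ : x₂ ∈ X)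
    (γ : ℝ → R3) (hγ : ContDiffOn ℝ ∞ γ (Icc 0 1)) (hγ_simple : InjOn γ (Icc 0 1))
    (hγ0 : γ 0 = x₁) (hγ1 : γ 1 = x₂)
    (R : ℝ) (hR : 0 < R)
    (hR₁ : ∀ u ∈ Ioo (0 : ℝ) 1, R ≤ u⁻¹ * (1 - u)⁻¹ * ‖γ u - x₁‖)
    (hR₂ : ∀ u ∈ Ioo (0 : ℝ) 1, R ≤ u⁻¹ * (1 - u)⁻¹ * ‖γ u - x₂‖)
    (hRX : ∀ y : R3, ‖y‖ < R → ∀ u ∈ Icc (0 : ℝ) 1, ∀ x ∈ X, x ≠ x₁ → x ≠ x₂ → nbrPath γ y u ≠ x)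
    (q : ℝ) (s : ScalarTest) (hs : tsupport s ⊆ Metric.ball 0 R) (hsq : ∫ x, s x = q) :
    ∃ b : ℝ → VectorTest,
      -- the functions `b_ε` are test functions supported in the complement of `X`
      (∀ ε ∈ Ioo (0 : ℝ) (1 / 2), (∀ x, b ε x = bridgeFun γ s ε x) ∧ tsupport (b ε) ⊆ (↑X)ᶜ) ∧
      -- the gauge bridge on `𝔄(ℝ³)` and its restriction to `𝔄(ℝ³ \ X)`
      ∃ (β : observables univ ≃⋆ₐ[ℂ] observables univ)
        (βX : observables (↑X)ᶜ ≃⋆ₐ[ℂ] observables (↑X)ᶜ),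
        (∀ a : observables univ,
          Tendsto (fun ε => Ad (expA (b ε)) (a : Op)) (𝓝[>] 0) (𝓝 (β a : Op))) ∧
        (∀ a : observables (↑X)ᶜ,
          (β (StarSubalgebra.inclusion (observables_mono (subset_univ _)) a) : Op) = βX a) ∧
        -- (i)
        (∀ (s' : ScalarTest) (hs' : tsupport s' ⊆ (↑X)ᶜ),
          βX (obsDivE (↑X)ᶜ s' hs') = obsDivE (↑X)ᶜ s' hs') ∧
        -- (ii)
        (∀ τ : Region, τ.surface ⊆ (↑X)ᶜ → ∃ δ > 0, ∀ s' : ScalarTest,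
          tsupport s' ⊆ Metric.ball 0 δ → ∫ x, s' x = 1 →
          ∃ (g : VectorTest) (hg : tsupport g ⊆ (↑X)ᶜ), (∀ x, g x = τ.surfaceFun s' x) ∧
            (x₁ ∉ τ.carrier → x₂ ∉ τ.carrier →
              βX (obsE (↑X)ᶜ g hg) = obsE (↑X)ᶜ g hg) ∧
            (x₁ ∈ τ.carrier → x₂ ∉ τ.carrier →
              βX (obsE (↑X)ᶜ g hg) = Complex.exp (Complex.I * q) • obsE (↑X)ᶜ g hg) ∧
            (x₁ ∉ τ.carrier → x₂ ∈ τ.carrier →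
              βX (obsE (↑X)ᶜ g hg) = Complex.exp (-(Complex.I * q)) • obsE (↑X)ᶜ g hg) ∧
            (x₁ ∈ τ.carrier → x₂ ∈ τ.carrier →
              βX (obsE (↑X)ᶜ g hg) = obsE (↑X)ᶜ g hg)) ∧
        -- (iii)
        (∀ O : Set R3, IsOpen O → IsCompact (closure O) → ContractibleIn (closure O) (↑X)ᶜ →
          ∃ f : VectorTest, tsupport f ⊆ (↑X)ᶜ ∧
            ∀ a : observables (↑X)ᶜ, (a : Op) ∈ observables O →
              (βX a : Op) = Ad (expB f) a) := by
  subst hγ0 hγ1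
  obtain ⟨b, hb, β, βX, hlim, hres, hdivE, hflux, hcurl⟩ := lemma3p2_general
    X.finite_toSet.isClosed hγ hx₁ hx₂ s (fun u hu y hy => nbrPath_notMem_of_norm_lt hu (hR₁ u hu)
      (hR₂ u hu) (fun x => hRX y (mem_ball_zero_iff.1 (hs hy)) u (Ioo_subset_Icc_self hu) x)
      (mem_ball_zero_iff.1 (hs hy))) hsq
  exact ⟨b, hb, β, βX, hlim, hres, hdivE, hflux, fun O _ => hcurl O⟩
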